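/- Let $\mathbb Y$ be the set of all Young diagrams. For $\lambda\in\mathbb Y$ let $|\lambda|$ be its number of boxes, $\dim\lambda$ the number of standard tableaux of shape $\lambda$, $c(\square)=j-i$ the content of the box $\square=(i,j)$, $\lambda^+$ the set of boxes $\square\notin\lambda$ such that $\lambda\cup\square$ is a Young diagram, and $\lambda^-$ the set of boxes $\square\in\lambda$ such that $\lambda\setminus\square$ is a Young diagram. Let $\operatorname{Sym}_{\mathbb C}$ be the algebra of symmetric functions over $\mathbb C$ with Newton power sums $p_k$ ($k\ge1$), and let $\mathbb A_{\mathbb C}$ be the algebra of functions on $\mathbb Y$ generated over $\mathbb C$ by the constants and the functions $$p_k(\lambda)=\sum_{i=1}^d\big[a_i^k-(-b_i)^k\big],\qquad k=1,2,\dots,$$ where $d$ is the number of diagonal boxes of $\lambda$, $a_i=\lambda_i-i+\tfrac12$ and $b_i=\lambda'_i-i+\tfrac12$ ($\lambda'$ is the transposed diagram). There is a unique algebra isomorphism $\operatorname{Sym}_{\mathbb C}\to\mathbb A_{\mathbb C}$, $F\mapsto F(\lambda)$, which takes each $p_k$ to the above function. For $\nu\in\mathbb Y$ there is a unique element $FS_\nu\in\operatorname{Sym}_{\mathbb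 C}$ (the Frobenius--Schur function) such that $$FS_\nu(\lambda)=\frac{\det\big[x_j(x_j-1)\cdots(x_j-n_i+1)\big]_{i,j=1}^N}{\prod_{1\le i<j\le N}(x_i-x_j)},\qquad x_j=\lambda_j+N-j,\quad n_i=\nu_i+N-i,$$ for every $\lambda\in\mathbb Y$ and every $N$ not smaller than the numbers of rows of $\lambda$ and $\nu$, and these elements form a basis of $\operatorname{Sym}_{\mathbb C}$. For $z,z',\xi\in\mathbb C$ with $\xi\ne1$ let the Meixner operator $\mathfrak D^{Me}:\operatorname{Sym}_{\mathbb C}\to\operatorname{Sym}_{\mathbb C}$ be the linear operator defined by $$\mathfrak D^{Me}FS_\nu=-|\nu|FS_\nu+\frac{\xi}{1-\xi}\sum_{\square\in\nu^-}(z+c(\square))(z'+c(\square))FS_{\nu\setminus\square},\qquad\nu\in\mathbb Y.$$ Then, under the identification of $\operatorname{Sym}_{\mathbb C}$ with $\mathbb A_{\mathbb C}$, the operator $\mathfrak D^{Me}$ is implemented by the following operator in the space of all complex functions on $\mathbb Y$, which can be written in two equivalent forms: $$\mathfrak D^{Me}f(\lambda)=\sum_{\square\in\lambda^+}A(\lambda,\square)f(\lambda\cup\square)+\sum_{\square\in\lambda^-}B(\lambda,\square)f(\lambda\setminus\square)-C(\lambda)f(\lambda)$$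 $$=\sum_{\square\in\lambda^+}A(\lambda,\square)\big(f(\lambda\cup\square)-f(\lambda)\big)+\sum_{\square\in\lambda^-}B(\lambda,\square)\big(f(\lambda\setminus\square)-f(\lambda)\big),$$ where $$A(\lambda,\square)=\frac{\xi}{1-\xi}(z+c(\square))(z'+c(\square))\frac{\dim(\lambda\cup\square)}{(|\lambda|+1)\dim\lambda},\quad\square\in\lambda^+,$$ $$B(\lambda,\square)=\frac1{1-\xi}\,\frac{|\lambda|\dim(\lambda\setminus\square)}{\dim\lambda},\quad\square\in\lambda^-,$$ $$C(\lambda)=\frac1{1-\xi}\big((1+\xi)|\lambda|+\xi zz'\big).$$ -/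

import Mathlib

noncomputable section

namespace MeixnerSym

/-! ### Young diagrams, boxes, dimensions -/

/-- The content `c(□) = j - i` of the box in row `i` and column `j`. -/
def content (c : ℕ × ℕ) : ℤ := (c.2 : ℤ) - (c.1 : ℤ)

open scoped Classical in
/-- `la⁻`: the boxes of `la` whose removal leaves a Young diagram. -/
def removable (la : YoungDiagram) : Finset (ℕ × ℕ) :=
  la.cells.filter fun c => IsLowerSet (la.cells.erase c : Set (ℕ × ℕ))

open scoped Classical in
/-- `la⁺`: the boxes outside `la` whose addition gives a Young diagram. The finite range over which
the filter is taken is no restriction, see `mem_addable`. -/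
def addable (la : YoungDiagram) : Finset (ℕ × ℕ) :=
  (Finset.range (la.colLen 0 + 1) ×ˢ Finset.range (la.rowLen 0 + 1)).filter fun c : ℕ × ℕ =>
    c ∉ la.cells ∧ IsLowerSet (insert c la.cells : Set (ℕ × ℕ))

theorem mem_removable {la : YoungDiagram} {c : ℕ × ℕ} :
    c ∈ removable la ↔ c ∈ la.cells ∧ IsLowerSet (la.cells.erase c : Set (ℕ × ℕ)) := by
  simp [removable]

theorem mem_addable {la : YoungDiagram} {c : ℕ × ℕ} :
    c ∈ addable la ↔ c ∉ la.cells ∧ IsLowerSet (insert c la.cells : Set (ℕ × ℕ)) := by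
  unfold addable
  simp only [Finset.mem_filter]
  refine ⟨fun h => h.2, fun h => ⟨?_, h⟩⟩
  obtain ⟨i, j⟩ := c
  obtain ⟨-, hl⟩ := h
  rw [Finset.mem_product, Finset.mem_range, Finset.mem_range]
  constructor
  · by_contra hi
    push Not at hi
    have hi' : la.colLen 0 + 1 ≤ i := hi
    have h1 : ((i - 1, 0) : ℕ × ℕ) ∈ (insert (i, j) la.cells : Set (ℕ × ℕ)) :=
      hl (show ((i - 1, 0) : ℕ × ℕ) ≤ (i, j) from ⟨Nat.sub_le _ _, Nat.zero_le _⟩)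
        (Set.mem_insert _ _)
    rcases h1 with h1 | h1
    · rw [Prod.mk.injEq] at h1
      omega
    · have h2 : ((i - 1, 0) : ℕ × ℕ) ∈ la := h1
      rw [YoungDiagram.mem_iff_lt_colLen] at h2
      omega
  · by_contra hj
    push Not at hj
    have hj' : la.rowLen 0 + 1 ≤ j := hj
    have h1 : ((0, j - 1) : ℕ × ℕ) ∈ (insert (i, j) la.cells : Set (ℕ × ℕ)) :=
      hl (show ((0, j - 1) : ℕ × ℕ) ≤ (i, j) from ⟨Nat.zero_le _, Nat.sub_le _ _⟩)
        (Set.mem_insert _ _)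
    rcases h1 with h1 | h1
    · rw [Prod.mk.injEq] at h1
      omega
    · have h2 : ((0, j - 1) : ℕ × ℕ) ∈ la := h1
      rw [YoungDiagram.mem_iff_lt_rowLen] at h2
      omega

open scoped Classical in
/-- `la ∖ □`, for `□ ∈ la⁻` (for other boxes, the value is `la`). -/
def removeBox (la : YoungDiagram) (c : ℕ × ℕ) : YoungDiagram :=
  if h : IsLowerSet (la.cells.erase c : Set (ℕ × ℕ)) then
    { cells := la.cells.erase c, isLowerSet := h }
  else la

open scoped Classical in
/-- `la ∪ □`, for `□ ∈ la⁺` (for other boxes, the value is `la`). -/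
def addBox (la : YoungDiagram) (c : ℕ × ℕ) : YoungDiagram :=
  if h : IsLowerSet (insert c la.cells : Set (ℕ × ℕ)) then
    { cells := insert c la.cells, isLowerSet := by simpa using h }
  else la

/-- A standard tableau of shape `la`: a bijective filling of the boxes by `|la|` consecutive
integers, increasing along the rows and along the columns. -/
structure StandardTableau (la : YoungDiagram) where
  entry : {c : ℕ × ℕ // c ∈ la.cells} ≃ Fin la.card
  row_lt : ∀ c d, c.1.1 = d.1.1 → c.1.2 < d.1.2 → entry c < entry d
  col_lt : ∀ c d, c.1.2 = d.1.2 → c.1.1 < d.1.1 → entry c < entry d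

/-- `dim la`: the number of standard tableaux of shape `la`. -/
def dim (la : YoungDiagram) : ℕ := Nat.card (StandardTableau la)

/-- The number `d` of diagonal boxes. -/
def diagLen (la : YoungDiagram) : ℕ := (la.cells.filter fun c => c.1 = c.2).card

/-- The modified Frobenius coordinate `a_i = la_i - i + 1/2` (rows are numbered from `0` here, so
that the `i` of the formula is `i + 1`). -/
def frobA (la : YoungDiagram) (i : ℕ) : ℂ := (la.rowLen i : ℂ) - ((i : ℂ) + 1) + 1 / 2

/-- The modified Frobenius coordinate `b_i`: the same quantity for the transposed diagram. -/
def frobB (la : YoungDiagram) (i : ℕ) : ℂ := frobA la.transpose i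

/-- The supersymmetric power sum `p_k(a; -b) = ∑ (a_i ^ k - (-b_i) ^ k)`, `k ≥ 1`, as a function
on the set of Young diagrams. -/
def powerFun (k : ℕ+) (la : YoungDiagram) : ℂ :=
  ∑ i ∈ Finset.range (diagLen la), (frobA la i ^ (k : ℕ) - (-frobB la i) ^ (k : ℕ))

/-- The (complexified) algebra `𝔸` of polynomial functions on the set of Young diagrams. -/
def PolyFun : Subalgebra ℂ (YoungDiagram → ℂ) := Algebra.adjoin ℂ (Set.range powerFun)

/-! ### Symmetric functions -/

/-- Setting the last variable equal to zero. -/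
def dropLast (N : ℕ) : MvPolynomial (Fin (N + 1)) ℂ →ₐ[ℂ] MvPolynomial (Fin N) ℂ :=
  MvPolynomial.aeval (Fin.lastCases 0 fun i => MvPolynomial.X i)

/-- The (complexified) algebra of symmetric functions: sequences of symmetric polynomials `f N` in
`N` variables, stable under setting the last variable equal to zero, of bounded degree. -/
def SymFun : Subalgebra ℂ (∀ N : ℕ, MvPolynomial (Fin N) ℂ) where
  carrier := {f | (∀ N, (f N).IsSymmetric) ∧ (∀ N, dropLast N (f (N + 1)) = f N) ∧
    ∃ d : ℕ, ∀ N, (f N).totalDegree ≤ d}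
  mul_mem' := by
    rintro f g ⟨hf, hf', d, hd⟩ ⟨hg, hg', e, he⟩
    refine ⟨fun N => (hf N).mul (hg N), fun N => ?_, d + e, fun N => ?_⟩
    · rw [Pi.mul_apply, map_mul, hf', hg', Pi.mul_apply]
    · exact (MvPolynomial.totalDegree_mul _ _).trans (add_le_add (hd N) (he N))
  add_mem' := by
    rintro f g ⟨hf, hf', d, hd⟩ ⟨hg, hg', e, he⟩
    refine ⟨fun N => (hf N).add (hg N), fun N => ?_, max d e, fun N => ?_⟩
    · rw [Pi.add_apply, map_add, hf', hg', Pi.add_apply]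
    · exact (MvPolynomial.totalDegree_add _ _).trans (max_le_max (hd N) (he N))
  algebraMap_mem' := by
    intro r
    refine ⟨fun N => MvPolynomial.IsSymmetric.C r, fun N => ?_, 0, fun N => ?_⟩
    · exact (dropLast N).commutes r
    · exact (MvPolynomial.totalDegree_C r).le

/-- The Newton power sum `p_k = ∑ x_i ^ k`, `k ≥ 1`, as a symmetric function. -/
def powerSum (k : ℕ+) : SymFun :=
  ⟨fun N => MvPolynomial.psum (Fin N) ℂ k, by
    refine ⟨fun N => MvPolynomial.psum_isSymmetric _ _ _, fun N => ?_, k, fun N => ?_⟩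
    · simp [dropLast, MvPolynomial.psum, Fin.sum_univ_castSucc]
    · refine MvPolynomial.totalDegree_finsetSum_le fun i _ => ?_
      exact (MvPolynomial.totalDegree_X_pow i (k : ℕ)).le⟩

/-- `Φ` is the identification of symmetric functions with polynomial functions on Young diagrams:
it takes the Newton power sum `p_k` to the function `p_k(a; -b)`. -/
def IsIdentification (Φ : SymFun ≃ₐ[ℂ] PolyFun) : Prop :=
  ∀ k : ℕ+, (Φ (powerSum k) : YoungDiagram → ℂ) = powerFun k

/-! ### Shifted Schur functions and Frobenius-Schur functions -/

/-- The value of the factorial Schur polynomial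
`det [x_j (x_j - 1) ⋯ (x_j - n_i + 1)] / ∏_{i < j} (x_i - x_j)`, `n_i = ν_i + N - i`, at a point
`x` with pairwise distinct coordinates, for `ν` with at most `N` rows (rows and coordinates are
numbered from `0`). -/
def factorialSchur (N : ℕ) (nu : YoungDiagram) (x : Fin N → ℂ) : ℂ :=
  (Matrix.of fun i j : Fin N =>
      (descPochhammer ℂ (nu.rowLen i + (N - 1 - (i : ℕ)))).eval (x j)).det /
    ∏ i : Fin N, ∏ j ∈ Finset.Ioi i, (x i - x j)

/-- The value of the `N`-variate shifted Schur polynomial with index `nu` at the row lengths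
`(la_1, …, la_N)` of the diagram `la`: the factorial Schur polynomial at the point with the
(strictly decreasing) coordinates `x_j = la_j + N - j`. -/
def shiftedSchur (N : ℕ) (nu la : YoungDiagram) : ℂ :=
  factorialSchur N nu fun j => ((la.rowLen j + (N - 1 - (j : ℕ)) : ℕ) : ℂ)

/-- The family `FS` consists of the Frobenius-Schur functions: as a function on Young diagrams,
`FS nu` is the shifted Schur function with index `nu` in the row lengths. -/
def IsFrobeniusSchur (Φ : SymFun ≃ₐ[ℂ] PolyFun) (FS : YoungDiagram → SymFun) : Prop :=
  ∀ (nu la : YoungDiagram) (N : ℕ), nu.colLen 0 ≤ N → la.colLen 0 ≤ N →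
    (Φ (FS nu) : YoungDiagram → ℂ) la = shiftedSchur N nu la

/-! ### The Meixner operator -/

/-- The Meixner operator with parameters `z, z', ξ`, defined by its action on the basis of
Frobenius-Schur functions. -/
def meixner (FS : Module.Basis YoungDiagram ℂ SymFun) (z z' ξ : ℂ) : SymFun →ₗ[ℂ] SymFun :=
  FS.constr ℂ fun nu => -(nu.card : ℂ) • FS nu +
    (ξ / (1 - ξ)) • ∑ c ∈ removable nu,
      ((z + (content c : ℂ)) * (z' + (content c : ℂ))) • FS (removeBox nu c)

/-- The coefficient of the addition of the box `c`. -/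
def coeffA (z z' ξ : ℂ) (la : YoungDiagram) (c : ℕ × ℕ) : ℂ :=
  ξ / (1 - ξ) * (z + (content c : ℂ)) * (z' + (content c : ℂ)) *
    ((dim (addBox la c) : ℂ) / (((la.card : ℂ) + 1) * (dim la : ℂ)))

/-- The coefficient of the removal of the box `c`. -/
def coeffB (ξ : ℂ) (la : YoungDiagram) (c : ℕ × ℕ) : ℂ :=
  1 / (1 - ξ) * ((la.card : ℂ) * (dim (removeBox la c) : ℂ) / (dim la : ℂ))

/-- The diagonal coefficient. -/
def coeffC (z z' ξ : ℂ) (la : YoungDiagram) : ℂ :=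
  1 / (1 - ξ) * ((1 + ξ) * (la.card : ℂ) + ξ * z * z')

end MeixnerSym

end

noncomputable section

namespace MeixnerSym

open Finset YoungDiagram

/-! ### Rows, boxes and contents of Young diagrams -/

/-! As a function on diagrams, $FS_\nu$ is the ratio $\det[x_j^{\downarrow n_i}]/V(x)$, where
$x^{\downarrow n}$ is the falling factorial and $V$ the product of the differences. The Meixner
operator and the difference operator are both linear, so they need only be compared on the basis
$FS_\nu$. Two identities suffice, `sum_removable_shiftedSchurFun` and `sum_addable_shiftedSchurFun`:
$\sum_{\lambda^-}\frac{|\lambda|\dim(\lambda\setminus\square)}{\dim\lambda}FS_\nu(\lambda\setminus\square)=(|\lambda|-|\nu|)FS_\nu(\lambda)$,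
$\sum_{\lambda^+}(z+c)(z'+c)\frac{\dim(\lambda\cup\square)}{(|\lambda|+1)\dim\lambda}FS_\nu(\lambda\cup\square)=(|\lambda|+|\nu|+zz')FS_\nu(\lambda)+\sum_{\nu^-}(z+c)(z'+c)FS_{\nu\setminus\square}(\lambda)$.
Adding them with weights $1/(1-\xi)$ and $\xi/(1-\xi)$ and subtracting $C(\lambda)FS_\nu(\lambda)$
leaves the definition of the Meixner operator. For $\nu=\varnothing$ they give $\sum A+\sum B=C$,
hence the second form of the operator.

Both identities are statements about determinants. The formula $\dim\lambda\prod_j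
x_j!=|\lambda|!\,V(x)$ (`dim_mul_coordFactorial`) turns the coefficients into ratios of values of
$V$, which cancel the denominators of $FS_\nu$. Adding or removing a box shifts one coordinate by
one; an illegal shift contributes zero. `sum_det_updateCol_eq` trades the sum over shifted columns
for a sum over altered rows, where recurrences for falling factorials apply.

For the basis property, multiplying $FS_\nu$ by $p_k$ gives a combination of functions $FS_\mu$ with
$|\mu|\le|\nu|+k$ (`powerFun_mul_shiftedSchurFun_mem`). So the products of the $p_k$ of weight at
most $d$ lie in the span of the $FS_\nu$ with $|\nu|\le d$. They are linearly independent and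
equally numerous, so a dimension count yields both independence and spanning.

The identification exists because the Newton power sums freely generate the symmetric functions, and
their counterparts on diagrams are algebraically independent. -/

theorem mem_cells_iff {la : YoungDiagram} {i j : ℕ} : (i, j) ∈ la.cells ↔ j < la.rowLen i :=
  mem_iff_lt_rowLen

theorem rowLen_eq_zero_iff {la : YoungDiagram} {i : ℕ} : la.rowLen i = 0 ↔ la.colLen 0 ≤ i := by
  rw [← not_lt, ← mem_iff_lt_colLen, mem_iff_lt_rowLen]
  omega

theorem rowLen_eq_of_mem_iff {mu : YoungDiagram} {i n : ℕ} (h : ∀ j, (i, j) ∈ mu ↔ j < n) :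
    mu.rowLen i = n := by
  have h1 : ∀ j, j < mu.rowLen i ↔ j < n := fun j => by rw [← mem_iff_lt_rowLen, h]
  have h2 := h1 n
  have h3 := h1 (mu.rowLen i)
  omega

@[simp] theorem rowLen_bot (i : ℕ) : (⊥ : YoungDiagram).rowLen i = 0 :=
  rowLen_eq_of_mem_iff fun j => by simp

@[simp] theorem colLen_bot (i : ℕ) : (⊥ : YoungDiagram).colLen i = 0 := by
  rw [← rowLen_transpose]
  exact rowLen_eq_of_mem_iff fun j => by simp

theorem eq_bot_of_card_eq_zero {la : YoungDiagram} (h : la.card = 0) : la = ⊥ := by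
  ext1
  simpa using h

theorem mem_addable_iff {la : YoungDiagram} {c : ℕ × ℕ} :
    c ∈ addable la ↔ c.2 = la.rowLen c.1 ∧ ∀ i, i < c.1 → la.rowLen c.1 < la.rowLen i := by
  obtain ⟨i, j⟩ := c
  rw [mem_addable, mem_cells_iff]
  constructor
  · rintro ⟨h1, h2⟩
    have key : ∀ a b, a ≤ i → b ≤ j → (a, b) ≠ (i, j) → b < la.rowLen a := by
      intro a b ha hb hab
      have := h2 (show ((a, b) : ℕ × ℕ) ≤ (i, j) from ⟨ha, hb⟩) (Set.mem_insert _ _)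
      rcases this with h | h
      · exact absurd h hab
      · exact mem_cells_iff.1 h
    have hj : j = la.rowLen i := by
      by_contra hne
      have := key i (la.rowLen i) le_rfl (by omega) (by simp; omega)
      omega
    refine ⟨hj, fun a ha => ?_⟩
    have := key a j (le_of_lt ha) le_rfl (by simp; omega)
    dsimp only
    omega
  · rintro ⟨h1, h2⟩
    dsimp only at h1 h2
    refine ⟨by omega, ?_⟩
    rintro ⟨a, b⟩ ⟨a', b'⟩ ⟨ha, hb⟩ h
    dsimp only at ha hb
    rcases h with h | h
    · rw [Prod.mk.injEq] at h
      obtain ⟨rfl, rfl⟩ := h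
      rcases ha.lt_or_eq with ha | rfl
      · exact Or.inr (mem_cells_iff.2 (by have := h2 _ ha; omega))
      · rcases hb.lt_or_eq with hb | rfl
        · exact Or.inr (mem_cells_iff.2 (by omega))
        · exact Or.inl rfl
    · exact Or.inr (la.isLowerSet (show ((a', b') : ℕ × ℕ) ≤ (a, b) from ⟨ha, hb⟩) h)

theorem mem_removable_iff {la : YoungDiagram} {c : ℕ × ℕ} :
    c ∈ removable la ↔ la.rowLen c.1 = c.2 + 1 ∧ la.rowLen (c.1 + 1) < la.rowLen c.1 := by
  obtain ⟨i, j⟩ := c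
  rw [mem_removable, mem_cells_iff]
  have hanti := la.rowLen_anti
  constructor
  · rintro ⟨h1, h2⟩
    have key : ∀ a b, i ≤ a → j ≤ b → (a, b) ≠ (i, j) → la.rowLen a ≤ b := by
      intro a b ha hb hab
      by_contra h
      have h3 : ((a, b) : ℕ × ℕ) ∈ (la.cells.erase (i, j) : Set (ℕ × ℕ)) := by
        rw [Finset.mem_coe, Finset.mem_erase]
        exact ⟨hab, mem_cells_iff.2 (by omega)⟩
      have := h2 (show ((i, j) : ℕ × ℕ) ≤ (a, b) from ⟨ha, hb⟩) h3
      simp at this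
    have e1 := key i (j + 1) le_rfl (by omega) (by simp)
    have e2 := key (i + 1) j (by omega) le_rfl (by simp)
    dsimp only
    omega
  · rintro ⟨h1, h2⟩
    dsimp only at h1 h2
    refine ⟨by omega, ?_⟩
    rintro ⟨a, b⟩ ⟨a', b'⟩ ⟨ha, hb⟩ h
    dsimp only at ha hb
    rw [Finset.mem_coe, Finset.mem_erase] at h ⊢
    refine ⟨?_, la.isLowerSet (show ((a', b') : ℕ × ℕ) ≤ (a, b) from ⟨ha, hb⟩) h.2⟩
    intro he
    rw [Prod.mk.injEq] at he
    obtain ⟨rfl, rfl⟩ := he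
    obtain ⟨h3, h4⟩ := h
    have h5 := mem_cells_iff.1 h4
    rcases ha.lt_or_eq with ha | rfl
    · have := hanti (a' + 1) a ha
      omega
    · apply h3
      rw [Prod.mk.injEq]
      exact ⟨rfl, by omega⟩

theorem cells_addBox {la : YoungDiagram} {c : ℕ × ℕ} (hc : c ∈ addable la) :
    (addBox la c).cells = insert c la.cells := by
  classical
  have := (mem_addable.1 hc).2
  unfold addBox
  rw [dif_pos this]

theorem cells_removeBox {la : YoungDiagram} {c : ℕ × ℕ} (hc : c ∈ removable la) :
    (removeBox la c).cells = la.cells.erase c := by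
  classical
  have := (mem_removable.1 hc).2
  unfold removeBox
  rw [dif_pos (by convert this)]

theorem card_addBox {la : YoungDiagram} {c : ℕ × ℕ} (hc : c ∈ addable la) :
    (addBox la c).card = la.card + 1 := by
  rw [YoungDiagram.card, cells_addBox hc, card_insert_of_notMem (mem_addable.1 hc).1]

theorem card_removeBox {la : YoungDiagram} {c : ℕ × ℕ} (hc : c ∈ removable la) :
    (removeBox la c).card + 1 = la.card := by
  rw [YoungDiagram.card, cells_removeBox hc, card_erase_add_one (mem_removable.1 hc).1]

theorem rowLen_addBox {la : YoungDiagram} {c : ℕ × ℕ} (hc : c ∈ addable la) (i : ℕ) :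
    (addBox la c).rowLen i = if i = c.1 then la.rowLen i + 1 else la.rowLen i := by
  apply rowLen_eq_of_mem_iff
  intro j
  rw [← YoungDiagram.mem_cells, cells_addBox hc, Finset.mem_insert, mem_cells_iff]
  have := (mem_addable_iff.1 hc).1
  obtain ⟨a, b⟩ := c
  dsimp only at this ⊢
  rw [Prod.mk.injEq]
  split_ifs with h
  · subst h; omega
  · omega

theorem rowLen_removeBox {la : YoungDiagram} {c : ℕ × ℕ} (hc : c ∈ removable la) (i : ℕ) :
    (removeBox la c).rowLen i = if i = c.1 then la.rowLen i - 1 else la.rowLen i := by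
  apply rowLen_eq_of_mem_iff
  intro j
  rw [← YoungDiagram.mem_cells, cells_removeBox hc, Finset.mem_erase, mem_cells_iff]
  have := (mem_removable_iff.1 hc).1
  obtain ⟨a, b⟩ := c
  dsimp only at this ⊢
  rw [ne_eq, Prod.mk.injEq]
  split_ifs with h
  · subst h; omega
  · omega

theorem colLen_addBox_le {la : YoungDiagram} {c : ℕ × ℕ} {N : ℕ} (hc : c ∈ addable la)
    (hN : la.colLen 0 < N) : (addBox la c).colLen 0 ≤ N := by
  rw [← rowLen_eq_zero_iff, rowLen_addBox hc, if_neg, rowLen_eq_zero_iff]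
  · omega
  · rintro rfl
    have h1 : la.rowLen c.1 = 0 := rowLen_eq_zero_iff.2 hN.le
    have h2 := (mem_addable_iff.1 hc).2 (la.colLen 0) hN
    have h3 : la.rowLen (la.colLen 0) = 0 := rowLen_eq_zero_iff.2 le_rfl
    omega

theorem colLen_removeBox_le {la : YoungDiagram} {c : ℕ × ℕ} {N : ℕ} (hc : c ∈ removable la)
    (hN : la.colLen 0 ≤ N) : (removeBox la c).colLen 0 ≤ N := by
  rw [← rowLen_eq_zero_iff, rowLen_removeBox hc]
  have := rowLen_eq_zero_iff.2 hN
  split_ifs <;> omega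

/-- A row admits at most one new box, so the sum can be indexed by rows; those without an addable
box must carry the value zero. The strict bound leaves room for a box opening a new row. -/
theorem sum_addable {la : YoungDiagram} {N : ℕ} (hN : la.colLen 0 < N) (f : ℕ × ℕ → ℂ)
    (g : ℕ → ℂ) (h0 : ∀ i < N, (i, la.rowLen i) ∈ addable la → g i = f (i, la.rowLen i))
    (h1 : ∀ i < N, (i, la.rowLen i) ∉ addable la → g i = 0) :
    ∑ c ∈ addable la, f c = ∑ i ∈ range N, g i := by
  have hinj : ∀ c ∈ addable la, c = (c.1, la.rowLen c.1) := fun c hc =>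
    Prod.ext rfl (mem_addable_iff.1 hc).1
  have hlt : ∀ c ∈ addable la, c.1 < N := by
    intro c hc
    by_contra h
    have h2 := (mem_addable_iff.1 hc).2 (la.colLen 0) (by omega)
    have h3 : la.rowLen (la.colLen 0) = 0 := rowLen_eq_zero_iff.2 le_rfl
    omega
  refine sum_of_injOn Prod.fst ?_ ?_ ?_ ?_
  · intro c hc d hd h
    rw [hinj c hc, hinj d hd, h]
  · intro c hc
    simpa using hlt c hc
  · intro i hi hni
    refine h1 i (mem_range.1 hi) fun h => hni ⟨_, h, rfl⟩
  · intro c hc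
    have := hinj c hc
    rw [h0 c.1 (hlt c hc) (this ▸ hc), ← this]

theorem sum_removable {la : YoungDiagram} {N : ℕ} (hN : la.colLen 0 ≤ N) (f : ℕ × ℕ → ℂ)
    (g : ℕ → ℂ)
    (h0 : ∀ i < N, la.rowLen (i + 1) < la.rowLen i → g i = f (i, la.rowLen i - 1))
    (h1 : ∀ i < N, la.rowLen (i + 1) = la.rowLen i → g i = 0) :
    ∑ c ∈ removable la, f c = ∑ i ∈ range N, g i := by
  have hinj : ∀ c ∈ removable la, c = (c.1, la.rowLen c.1 - 1) := fun c hc =>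
    Prod.ext rfl (by have := (mem_removable_iff.1 hc).1; simp only; omega)
  have hlt : ∀ c ∈ removable la, c.1 < N := by
    intro c hc
    by_contra h
    have h2 := (mem_removable_iff.1 hc).2
    have h3 : la.rowLen c.1 = 0 := rowLen_eq_zero_iff.2 (by omega)
    omega
  refine sum_of_injOn Prod.fst ?_ ?_ ?_ ?_
  · intro c hc d hd h
    rw [hinj c hc, hinj d hd, h]
  · intro c hc
    simpa using hlt c hc
  · intro i hi hni
    rcases (la.rowLen_anti i (i + 1) (Nat.le_succ i)).lt_or_eq with h | h
    · exact absurd ⟨(i, la.rowLen i - 1),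
        mem_removable_iff.2 ⟨by dsimp only; omega, h⟩, rfl⟩ hni
    · exact h1 i (mem_range.1 hi) h
  · intro c hc
    have := hinj c hc
    rw [h0 c.1 (hlt c hc) (mem_removable_iff.1 hc).2, ← this]

theorem sum_cells {M : Type*} [AddCommMonoid M] {la : YoungDiagram} {N : ℕ}
    (hN : la.colLen 0 ≤ N) (f : ℕ × ℕ → M) :
    ∑ c ∈ la.cells, f c = ∑ i ∈ range N, ∑ j ∈ range (la.rowLen i), f (i, j) := by
  rw [sum_sigma']
  refine (sum_bij' (fun x _ => (x.1, x.2)) (fun c _ => ⟨c.1, c.2⟩) ?_ ?_ ?_ ?_ ?_).symm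
  · rintro ⟨i, j⟩ h
    simpa [mem_cells_iff, mem_iff_lt_rowLen] using (mem_sigma.1 h).2
  · rintro ⟨i, j⟩ h
    have h' := mem_cells_iff.1 h
    rw [mem_sigma, mem_range, mem_range]
    refine ⟨?_, h'⟩
    by_contra hi
    have : la.rowLen i = 0 := rowLen_eq_zero_iff.2 (by dsimp only at hi; omega)
    omega
  · rintro ⟨i, j⟩ h; rfl
  · rintro ⟨i, j⟩ h; rfl
  · rintro ⟨i, j⟩ h; rfl

theorem card_eq_sum_rowLen {la : YoungDiagram} {N : ℕ} (hN : la.colLen 0 ≤ N) :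
    la.card = ∑ i ∈ range N, la.rowLen i := by
  rw [YoungDiagram.card, card_eq_sum_ones, sum_cells hN]
  simp

/-! ### Power sums in Frobenius coordinates as sums over boxes and over rows. -/

theorem mem_diagonal_iff {la : YoungDiagram} {i : ℕ} : (i, i) ∈ la ↔ i < diagLen la := by
  have himg : (la.cells.filter fun c => c.1 = c.2).image Prod.fst =
      (range (la.colLen 0)).filter fun i => (i, i) ∈ la := by
    ext i
    simp only [mem_image, mem_filter, mem_range, Prod.exists, YoungDiagram.mem_cells]
    constructor
    · rintro ⟨a, b, ⟨h, rfl⟩, rfl⟩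
      exact ⟨mem_iff_lt_colLen.1 (la.up_left_mem le_rfl (Nat.zero_le _) h), h⟩
    · rintro ⟨-, h⟩
      exact ⟨i, i, ⟨h, rfl⟩, rfl⟩
  have hcard : diagLen la = ((range (la.colLen 0)).filter fun i => (i, i) ∈ la).card := by
    rw [← himg, card_image_of_injOn, diagLen]
    rintro ⟨a, b⟩ h ⟨a', b'⟩ h' hab
    simp only [coe_filter, Set.mem_ofPred_eq] at h h' hab ⊢
    obtain ⟨-, rfl⟩ := h
    obtain ⟨-, rfl⟩ := h'
    rw [hab]
  have hdown : ∀ a b : ℕ, a ≤ b → (b, b) ∈ la → (a, a) ∈ la := fun a b h hb =>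
    la.up_left_mem h h hb
  have hcol : ∀ a, (a, a) ∈ la → a < la.colLen 0 := fun a h =>
    mem_iff_lt_colLen.1 (la.up_left_mem le_rfl (Nat.zero_le _) h)
  constructor
  · intro h
    have : range (i + 1) ⊆ (range (la.colLen 0)).filter fun i => (i, i) ∈ la := by
      intro a ha
      have hd := hdown a i (by simpa [Nat.lt_succ_iff] using ha) h
      exact mem_filter.2 ⟨mem_range.2 (hcol a hd), hd⟩
    have := card_le_card this
    rw [card_range] at this
    omega
  · intro h
    by_contra hn
    have : ((range (la.colLen 0)).filter fun i => (i, i) ∈ la) ⊆ range i := by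
      intro a ha
      rw [mem_range]
      by_contra hia
      exact hn (hdown i a (by omega) (mem_filter.1 ha).2)
    have := card_le_card this
    rw [card_range] at this
    omega

theorem diagLen_le_rowLen {la : YoungDiagram} {i : ℕ} (hi : i < diagLen la) : i < la.rowLen i :=
  mem_iff_lt_rowLen.1 (mem_diagonal_iff.2 hi)

theorem diagLen_le_colLen {la : YoungDiagram} {i : ℕ} (hi : i < diagLen la) : i < la.colLen i :=
  mem_iff_lt_colLen.1 (mem_diagonal_iff.2 hi)

/-- The sum telescopes along each hook with corner on the diagonal. The arm, diagonal box included,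
gives $a_i^k-(-1/2)^k$ and the leg gives $(-1/2)^k-(-b_i)^k$. -/
theorem powerFun_eq_sum_cells (k : ℕ+) (la : YoungDiagram) :
    powerFun k la = ∑ c ∈ la.cells,
      (((content c : ℂ) + 1 / 2) ^ (k : ℕ) - ((content c : ℂ) - 1 / 2) ^ (k : ℕ)) := by
  have hsplit := sum_filter_add_sum_filter_not la.cells (fun c => c.1 ≤ c.2)
    (fun c => (((content c : ℂ) + 1 / 2) ^ (k : ℕ) - ((content c : ℂ) - 1 / 2) ^ (k : ℕ)))
  rw [← hsplit, powerFun]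
  have hA : ∀ f : ℕ × ℕ → ℂ, ∑ c ∈ la.cells.filter (fun c => c.1 ≤ c.2), f c =
      ∑ i ∈ range (diagLen la), ∑ j ∈ range (la.rowLen i - i), f (i, i + j) := by
    intro f
    rw [sum_sigma']
    refine (sum_bij' (fun x _ => (x.1, x.1 + x.2)) (fun c _ => ⟨c.1, c.2 - c.1⟩)
      ?_ ?_ ?_ ?_ ?_).symm
    · rintro ⟨i, j⟩ h
      simp only [mem_sigma, mem_range] at h ⊢
      rw [mem_filter, mem_cells_iff]
      exact ⟨by omega, by simp⟩
    · rintro ⟨i, j⟩ h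
      simp only [mem_filter, mem_cells_iff] at h
      simp only [mem_sigma, mem_range]
      refine ⟨mem_diagonal_iff.1 (la.up_left_mem le_rfl h.2 (mem_cells_iff.2 h.1)), by omega⟩
    · rintro ⟨i, j⟩ h; simp
    · rintro ⟨i, j⟩ h
      simp only [mem_filter] at h
      rw [Prod.mk.injEq]
      exact ⟨rfl, by dsimp only; omega⟩
    · rintro ⟨i, j⟩ h; rfl
  have hB : ∀ f : ℕ × ℕ → ℂ, ∑ c ∈ la.cells.filter (fun c => ¬ c.1 ≤ c.2), f c =
      ∑ i ∈ range (diagLen la), ∑ j ∈ range (la.colLen i - (i + 1)), f (i + 1 + j, i) := by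
    intro f
    rw [sum_sigma']
    refine (sum_bij' (fun x _ => (x.1 + 1 + x.2, x.1)) (fun c _ => ⟨c.2, c.1 - (c.2 + 1)⟩)
      ?_ ?_ ?_ ?_ ?_).symm
    · rintro ⟨i, j⟩ h
      simp only [mem_sigma, mem_range] at h ⊢
      rw [mem_filter, YoungDiagram.mem_cells, mem_iff_lt_colLen]
      exact ⟨by omega, by dsimp only; omega⟩
    · rintro ⟨i, j⟩ h
      simp only [mem_filter, YoungDiagram.mem_cells] at h
      simp only [mem_sigma, mem_range]
      have := mem_iff_lt_colLen.1 h.1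
      refine ⟨mem_diagonal_iff.1 (la.up_left_mem (by omega) le_rfl h.1), by omega⟩
    · rintro ⟨i, j⟩ h; simp
    · rintro ⟨i, j⟩ h
      simp only [mem_filter] at h
      rw [Prod.mk.injEq]
      exact ⟨by dsimp only; omega, rfl⟩
    · rintro ⟨i, j⟩ h; rfl
  rw [hA, hB, ← sum_add_distrib]
  refine sum_congr rfl fun i hi => ?_
  have h1 := diagLen_le_rowLen (mem_range.1 hi)
  have h2 := diagLen_le_colLen (mem_range.1 hi)
  have t1 := sum_range_sub (fun j : ℕ => ((j : ℂ) - 1 / 2) ^ (k : ℕ)) (la.rowLen i - i)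
  have t2 := sum_range_sub' (fun j : ℕ => (-(j : ℂ) - 1 / 2) ^ (k : ℕ)) (la.colLen i - (i + 1))
  rw [sum_congr rfl (g := fun j : ℕ =>
      (((j + 1 : ℕ) : ℂ) - 1 / 2) ^ (k : ℕ) - ((j : ℂ) - 1 / 2) ^ (k : ℕ)), t1,
    sum_congr rfl (g := fun j : ℕ =>
      (-(j : ℂ) - 1 / 2) ^ (k : ℕ) - (-((j + 1 : ℕ) : ℂ) - 1 / 2) ^ (k : ℕ)), t2]
  · rw [frobB, frobA, frobA, rowLen_transpose, Nat.cast_sub h1.le, Nat.cast_sub h2]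
    push_cast
    ring
  · intro j _
    simp only [content]
    push_cast
    ring
  · intro j _
    simp only [content]
    push_cast
    ring

/-- The same sum over boxes, now telescoped along entire rows. This form matches the coordinates in
the determinants. -/
theorem powerFun_eq_sum_rows (k : ℕ+) {la : YoungDiagram} {N : ℕ} (hN : la.colLen 0 ≤ N) :
    powerFun k la = ∑ i ∈ range N,
      (((la.rowLen i : ℂ) - i - 1 / 2) ^ (k : ℕ) - (-(i : ℂ) - 1 / 2) ^ (k : ℕ)) := by
  rw [powerFun_eq_sum_cells, sum_cells hN]
  refine sum_congr rfl fun i _ => ?_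
  have t1 := sum_range_sub (fun j : ℕ => ((j : ℂ) - i - 1 / 2) ^ (k : ℕ)) (la.rowLen i)
  rw [sum_congr rfl (g := fun j : ℕ =>
      (((j + 1 : ℕ) : ℂ) - i - 1 / 2) ^ (k : ℕ) - ((j : ℂ) - i - 1 / 2) ^ (k : ℕ)), t1]
  · simp
  · intro j _
    simp only [content]
    push_cast
    ring

/-- The Young diagram with prescribed weakly decreasing row lengths, vanishing from `M` on. -/
def diagramOfRows (a : ℕ → ℕ) (M : ℕ) (ha : Antitone a) : YoungDiagram where
  cells := (range M ×ˢ range (a 0)).filter fun c => c.2 < a c.1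
  isLowerSet := by
    rintro ⟨i, j⟩ ⟨i', j'⟩ ⟨hi, hj⟩ h
    simp only [coe_filter, Set.mem_ofPred_eq, mem_product, mem_range] at h hi hj ⊢
    have := ha hi
    omega

theorem rowLen_diagramOfRows {a : ℕ → ℕ} {M : ℕ} (ha : Antitone a) (hM : ∀ i, M ≤ i → a i = 0)
    (i : ℕ) : (diagramOfRows a M ha).rowLen i = a i := by
  apply rowLen_eq_of_mem_iff
  intro j
  rw [← YoungDiagram.mem_cells, diagramOfRows]
  simp only [mem_filter, mem_product, mem_range]
  have h1 := ha (Nat.zero_le i)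
  have h2 := hM i
  omega

/-! ### Determinants of falling factorials -/

/-- The falling factorial `x (x - 1) ⋯ (x - n + 1)`. -/
def fallPow (n : ℕ) (x : ℂ) : ℂ := (descPochhammer ℂ n).eval x

@[simp] theorem fallPow_zero (x : ℂ) : fallPow 0 x = 1 := by simp [fallPow]

theorem fallPow_succ (n : ℕ) (x : ℂ) : fallPow (n + 1) x = fallPow n x * (x - n) := by
  simp [fallPow, descPochhammer_succ_eval]

theorem fallPow_succ_add_one (n : ℕ) (x : ℂ) : fallPow (n + 1) (x + 1) = (x + 1) * fallPow n x := by
  simp [fallPow, descPochhammer_succ_left]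

theorem fallPow_succ_zero (n : ℕ) : fallPow (n + 1) 0 = 0 := by
  simp [fallPow, descPochhammer_ne_zero_eval_zero]

theorem mul_fallPow_sub_one (n : ℕ) (x : ℂ) : x * fallPow n (x - 1) = fallPow (n + 1) x := by
  have := fallPow_succ_add_one n (x - 1)
  rw [sub_add_cancel] at this
  exact this.symm

/-- The matrix of the falling factorials of orders `n i` at the points `x j`. -/
def fallMat {N : ℕ} (n : Fin N → ℕ) (x : Fin N → ℂ) : Matrix (Fin N) (Fin N) ℂ :=
  Matrix.of fun i j => fallPow (n i) (x j)

/-- The determinant of the falling factorials of orders `n i` at the points `x j`. -/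
def fallDet {N : ℕ} (n : Fin N → ℕ) (x : Fin N → ℂ) : ℂ := (fallMat n x).det

theorem fallDet_eq_zero_of_row {N : ℕ} {n : Fin N → ℕ} {i j : Fin N} (hij : i ≠ j)
    (h : n i = n j) (x : Fin N → ℂ) : fallDet n x = 0 :=
  Matrix.det_zero_of_row_eq hij (by ext k; simp [fallMat, h])

theorem fallDet_eq_zero_of_column {N : ℕ} {x : Fin N → ℂ} {i j : Fin N} (hij : i ≠ j)
    (h : x i = x j) (n : Fin N → ℕ) : fallDet n x = 0 :=
  Matrix.det_zero_of_column_eq hij (by intro k; simp [fallMat, h])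

theorem fallDet_comp_swap {N : ℕ} (n : Fin N → ℕ) {i j : Fin N} (hij : i ≠ j) (x : Fin N → ℂ) :
    fallDet (n ∘ Equiv.swap i j) x = -fallDet n x := by
  have : fallMat (n ∘ Equiv.swap i j) x = (fallMat n x).submatrix (Equiv.swap i j) id := rfl
  rw [fallDet, this, Matrix.det_permute, Equiv.Perm.sign_swap hij, fallDet]
  simp

theorem fallDet_update_row {N : ℕ} (n : Fin N → ℕ) (x : Fin N → ℂ) (i : Fin N) (m : ℕ) :
    ((fallMat n x).updateRow i fun j => fallPow m (x j)).det =
      fallDet (Function.update n i m) x := by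
  rw [fallDet]
  congr 1
  ext a b
  rcases eq_or_ne a i with rfl | h
  · simp [fallMat]
  · simp [fallMat, h]

/-- Cramer's rule expands both sides into $\operatorname{tr}(\operatorname{adj}(A)B)$. -/
theorem sum_det_updateCol_eq {N : ℕ} (A : Matrix (Fin N) (Fin N) ℂ) (B : Fin N → Fin N → ℂ) :
    ∑ j, (A.updateCol j fun i => B i j).det = ∑ i, (A.updateRow i (B i)).det := by
  have h1 : ∀ j, (A.updateCol j fun i => B i j).det = ∑ i, A.adjugate j i * B i j := by
    intro j
    rw [← Matrix.cramer_apply, Matrix.cramer_eq_adjugate_mulVec]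
    rfl
  have h2 : ∀ i, (A.updateRow i (B i)).det = ∑ j, A.adjugate j i * B i j := by
    intro i
    rw [← Matrix.cramer_transpose_apply, Matrix.cramer_eq_adjugate_mulVec,
      ← Matrix.adjugate_transpose]
    simp [Matrix.mulVec, dotProduct]
  rw [sum_congr rfl fun j _ => h1 j, sum_congr rfl fun i _ => h2 i, sum_comm]

/-- A sum of determinants with one shifted variable, as a sum of determinants with one changed
row. -/
theorem sum_mul_fallDet_update {N : ℕ} (n : Fin N → ℕ) (x : Fin N → ℂ) (w : ℂ → ℂ) (s : ℂ) :
    ∑ j, w (x j) * fallDet n (Function.update x j (x j + s)) =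
      ∑ i, ((fallMat n x).updateRow i fun j => w (x j) * fallPow (n i) (x j + s)).det := by
  rw [← sum_det_updateCol_eq (fallMat n x) fun i j => w (x j) * fallPow (n i) (x j + s)]
  refine sum_congr rfl fun j _ => ?_
  have h : fallMat n (Function.update x j (x j + s)) =
      (fallMat n x).updateCol j fun i => fallPow (n i) (x j + s) := by
    ext a b
    rcases eq_or_ne b j with rfl | h
    · simp [fallMat]
    · simp [fallMat, h]
  rw [fallDet, h, ← Matrix.det_updateCol_smul]
  rfl

/-- The row orders, or the coordinates, attached to a sequence of row lengths. -/
def shiftRows (N : ℕ) (a : ℕ → ℕ) (i : Fin N) : ℕ := a i + (N - 1 - (i : ℕ))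

/-- The coordinates `x_j = la_j + N - j` of a Young diagram. -/
def coords (N : ℕ) (la : YoungDiagram) (j : Fin N) : ℂ := (shiftRows N la.rowLen j : ℂ)

/-- The product of the differences `x_i - x_j`, `i < j`. -/
def vandermondeProd {N : ℕ} (x : Fin N → ℂ) : ℂ := ∏ i : Fin N, ∏ j ∈ Ioi i, (x i - x j)

theorem shiftedSchur_eq (N : ℕ) (nu la : YoungDiagram) :
    shiftedSchur N nu la =
      fallDet (shiftRows N nu.rowLen) (coords N la) / vandermondeProd (coords N la) := rfl

theorem vandermondeProd_ne_zero {N : ℕ} {x : Fin N → ℂ} (hx : Function.Injective x) :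
    vandermondeProd x ≠ 0 := by
  refine prod_ne_zero_iff.2 fun i _ => prod_ne_zero_iff.2 fun j hj => ?_
  rw [sub_ne_zero]
  exact fun h => (mem_Ioi.1 hj).ne (hx h)

/-- Falling factorials are monic of the expected degrees, so the determinant is of Vandermonde type.
The reversal of indices accounts for the decreasing orders and the sign convention $x_i-x_j$. -/
theorem fallDet_shiftRows_zero {N : ℕ} (x : Fin N → ℂ) :
    fallDet (shiftRows N fun _ => 0) x = vandermondeProd x := by
  have h := Matrix.det_eval_matrixOfPolynomials_eq_det_vandermonde (fun i => x (Fin.rev i))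
    (fun i : Fin N => descPochhammer ℂ i) (fun i => descPochhammer_natDegree ℂ i)
    (fun i => monic_descPochhammer ℂ i)
  rw [Matrix.det_vandermonde] at h
  have h1 : fallDet (shiftRows N fun _ => 0) x =
      (Matrix.of fun i j : Fin N => (descPochhammer ℂ j).eval (x (Fin.rev i))).det := by
    rw [fallDet, ← Matrix.det_transpose, ← Matrix.det_submatrix_equiv_self Fin.revPerm]
    congr 1
    ext i j
    simp only [fallMat, Matrix.submatrix_apply, Matrix.transpose_apply, Matrix.of_apply,
      Fin.revPerm_apply, shiftRows, fallPow, Fin.val_rev]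
    congr 2
    omega
  rw [h1, ← h, vandermondeProd]
  rw [prod_sigma', prod_sigma']
  refine prod_bij' (fun p _ => ⟨Fin.rev p.2, Fin.rev p.1⟩) (fun p _ => ⟨Fin.rev p.2, Fin.rev p.1⟩)
    ?_ ?_ ?_ ?_ ?_
  · rintro ⟨i, j⟩ h; simpa using h
  · rintro ⟨i, j⟩ h; simpa using h
  · rintro ⟨i, j⟩ h; simp
  · rintro ⟨i, j⟩ h; simp
  · rintro ⟨i, j⟩ h; simp

theorem shiftRows_strictAnti {N : ℕ} {a : ℕ → ℕ} (ha : Antitone a) :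
    StrictAnti (shiftRows N a) := by
  intro i j hij
  have h1 : (i : ℕ) < j := hij
  have h2 := ha h1.le
  have h3 := j.2
  simp only [shiftRows]
  omega

theorem rowLen_antitone (la : YoungDiagram) : Antitone la.rowLen := fun i j h => la.rowLen_anti i j h

theorem coords_injective (N : ℕ) (la : YoungDiagram) : Function.Injective (coords N la) :=
  Nat.cast_injective.comp (shiftRows_strictAnti (rowLen_antitone la)).injective

theorem vandermondeProd_coords_ne_zero (N : ℕ) (la : YoungDiagram) :
    vandermondeProd (coords N la) ≠ 0 :=
  vandermondeProd_ne_zero (coords_injective N la)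

theorem shiftedSchur_mul (N : ℕ) (nu la : YoungDiagram) :
    shiftedSchur N nu la * vandermondeProd (coords N la) =
      fallDet (shiftRows N nu.rowLen) (coords N la) := by
  rw [shiftedSchur_eq, div_mul_cancel₀ _ (vandermondeProd_coords_ne_zero N la)]

theorem shiftedSchur_bot (N : ℕ) (la : YoungDiagram) : shiftedSchur N ⊥ la = 1 := by
  have : (⊥ : YoungDiagram).rowLen = fun _ => 0 := funext rowLen_bot
  rw [shiftedSchur_eq, this, fallDet_shiftRows_zero,
    div_self (vandermondeProd_coords_ne_zero N la)]

/-! ### Stability in the number of variables. -/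

theorem shiftRows_castSucc {N : ℕ} (a : ℕ → ℕ) (i : Fin N) :
    shiftRows (N + 1) a i.castSucc = shiftRows N a i + 1 := by
  have := i.2
  simp only [shiftRows, Fin.val_castSucc]
  omega

theorem shiftRows_last {N : ℕ} (a : ℕ → ℕ) : shiftRows (N + 1) a (Fin.last N) = a N := by
  simp [shiftRows]

/-- All rows but the last have positive order and vanish at $0$, so the last column has the single
nonzero entry $1$. In the remaining minor, $x^{\downarrow(n+1)}=x(x-1)^{\downarrow n}$ lets a factor
be taken out of each column. -/
theorem fallDet_shiftRows_succ {N : ℕ} {a : ℕ → ℕ} (ha : a N = 0) {x : Fin (N + 1) → ℂ}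
    (hx : x (Fin.last N) = 0) :
    fallDet (shiftRows (N + 1) a) x =
      (∏ j : Fin N, x j.castSucc) * fallDet (shiftRows N a) fun j => x j.castSucc - 1 := by
  rw [fallDet, Matrix.det_succ_column _ (Fin.last N), Fin.sum_univ_castSucc]
  rw [sum_eq_zero, zero_add, fallDet, ← Matrix.det_mul_row]
  · have h1 : fallMat (shiftRows (N + 1) a) x (Fin.last N) (Fin.last N) = 1 := by
      simp [fallMat, shiftRows_last, ha]
    rw [h1, Fin.succAbove_last, ← two_mul, pow_mul]
    simp only [neg_one_sq, one_pow, one_mul]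
    congr 1
    ext i j
    simp only [fallMat, Matrix.submatrix_apply, Matrix.of_apply, shiftRows_castSucc,
      ← mul_fallPow_sub_one]
  · intro i _
    have : fallMat (shiftRows (N + 1) a) x i.castSucc (Fin.last N) = 0 := by
      simp [fallMat, shiftRows_castSucc, hx, fallPow_succ_zero]
    rw [this]
    ring

theorem coords_last {N : ℕ} {la : YoungDiagram} (h : la.colLen 0 ≤ N) :
    coords (N + 1) la (Fin.last N) = 0 := by
  rw [coords, shiftRows_last, rowLen_eq_zero_iff.2 h, Nat.cast_zero]

theorem coords_castSucc (N : ℕ) (la : YoungDiagram) (j : Fin N) :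
    coords (N + 1) la j.castSucc = coords N la j + 1 := by
  rw [coords, shiftRows_castSucc, Nat.cast_add, Nat.cast_one, coords]

theorem fallDet_coords_succ {N : ℕ} {a : ℕ → ℕ} {la : YoungDiagram} (ha : a N = 0)
    (hl : la.colLen 0 ≤ N) :
    fallDet (shiftRows (N + 1) a) (coords (N + 1) la) =
      (∏ j : Fin N, (coords N la j + 1)) * fallDet (shiftRows N a) (coords N la) := by
  rw [fallDet_shiftRows_succ ha (coords_last hl)]
  simp only [coords_castSucc, add_sub_cancel_right]

theorem coords_add_one_ne_zero (N : ℕ) (la : YoungDiagram) (j : Fin N) :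
    coords N la j + 1 ≠ 0 := by
  rw [coords]
  exact Nat.cast_add_one_ne_zero _

/-- The denominator is the determinant with all row lengths zero, so it acquires the same factor
$\prod_j(x_j+1)$ as the numerator. -/
theorem shiftedSchur_succ {N : ℕ} {nu la : YoungDiagram} (hn : nu.colLen 0 ≤ N)
    (hl : la.colLen 0 ≤ N) : shiftedSchur (N + 1) nu la = shiftedSchur N nu la := by
  rw [shiftedSchur_eq, shiftedSchur_eq, ← fallDet_shiftRows_zero, ← fallDet_shiftRows_zero,
    fallDet_coords_succ (rowLen_eq_zero_iff.2 hn) hl, fallDet_coords_succ rfl hl,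
    mul_div_mul_left _ _ (prod_ne_zero_iff.2 fun j _ => coords_add_one_ne_zero N la j)]

theorem shiftedSchur_stable {N M : ℕ} {nu la : YoungDiagram} (hn : nu.colLen 0 ≤ N)
    (hl : la.colLen 0 ≤ N) (h : N ≤ M) : shiftedSchur M nu la = shiftedSchur N nu la := by
  induction M, h using Nat.le_induction with
  | base => rfl
  | succ M h ih => rw [shiftedSchur_succ (hn.trans h) (hl.trans h), ih]

/-- The shifted Schur function with index `nu`, as a function on Young diagrams. -/
def shiftedSchurFun (nu la : YoungDiagram) : ℂ :=
  shiftedSchur (max (nu.colLen 0) (la.colLen 0)) nu la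

theorem shiftedSchur_eq_fun {N : ℕ} {nu la : YoungDiagram} (hn : nu.colLen 0 ≤ N)
    (hl : la.colLen 0 ≤ N) : shiftedSchur N nu la = shiftedSchurFun nu la :=
  shiftedSchur_stable (le_max_left _ _) (le_max_right _ _) (max_le hn hl)

theorem shiftedSchurFun_mul {N : ℕ} {nu la : YoungDiagram} (hn : nu.colLen 0 ≤ N)
    (hl : la.colLen 0 ≤ N) :
    shiftedSchurFun nu la * vandermondeProd (coords N la) =
      fallDet (shiftRows N nu.rowLen) (coords N la) := by
  rw [← shiftedSchur_eq_fun hn hl, shiftedSchur_mul]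

theorem shiftedSchurFun_bot (la : YoungDiagram) : shiftedSchurFun ⊥ la = 1 := shiftedSchur_bot _ _

/-! ### The branching rule for the number of standard tableaux -/

/-- A standard tableau as a function on `ℕ × ℕ` vanishing outside the diagram. -/
structure IsFilling (la : YoungDiagram) (f : ℕ × ℕ → ℕ) : Prop where
  zero : ∀ c, c ∉ la.cells → f c = 0
  lt_card : ∀ c ∈ la.cells, f c < la.card
  injOn : Set.InjOn f la.cells
  row_lt : ∀ c ∈ la.cells, ∀ d ∈ la.cells, c.1 = d.1 → c.2 < d.2 → f c < f d
  col_lt : ∀ c ∈ la.cells, ∀ d ∈ la.cells, c.2 = d.2 → c.1 < d.1 → f c < f d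

/-- The filling underlying a standard tableau. -/
def StandardTableau.filling {la : YoungDiagram} (t : StandardTableau la) (c : ℕ × ℕ) : ℕ :=
  if h : c ∈ la.cells then t.entry ⟨c, h⟩ else 0

theorem StandardTableau.filling_of_mem {la : YoungDiagram} (t : StandardTableau la) {c : ℕ × ℕ}
    (h : c ∈ la.cells) : t.filling c = t.entry ⟨c, h⟩ := dif_pos h

theorem StandardTableau.isFilling {la : YoungDiagram} (t : StandardTableau la) :
    IsFilling la t.filling where
  zero c hc := dif_neg hc
  lt_card c hc := by rw [t.filling_of_mem hc]; exact Fin.is_lt _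
  injOn c hc d hd h := by
    rw [t.filling_of_mem hc, t.filling_of_mem hd, Fin.val_inj, t.entry.apply_eq_iff_eq] at h
    exact congrArg Subtype.val h
  row_lt c hc d hd h h' := by
    rw [t.filling_of_mem hc, t.filling_of_mem hd]
    exact t.row_lt ⟨c, hc⟩ ⟨d, hd⟩ h h'
  col_lt c hc d hd h h' := by
    rw [t.filling_of_mem hc, t.filling_of_mem hd]
    exact t.col_lt ⟨c, hc⟩ ⟨d, hd⟩ h h'

/-- Standard tableaux are the same as fillings. -/
def tableauEquiv (la : YoungDiagram) : StandardTableau la ≃ {f // IsFilling la f} :=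
  Equiv.ofBijective (fun t => ⟨t.filling, t.isFilling⟩) <| by
    constructor
    · rintro ⟨e, h1, h2⟩ ⟨e', h1', h2'⟩ h
      have h := congrArg Subtype.val h
      have he : e = e' := by
        ext c
        have := congrFun h c.1
        dsimp only at this
        rwa [StandardTableau.filling_of_mem _ c.2, StandardTableau.filling_of_mem _ c.2] at this
      subst he
      rfl
    · rintro ⟨f, hf⟩
      let g : {c : ℕ × ℕ // c ∈ la.cells} → Fin la.card := fun c => ⟨f c, hf.lt_card c c.2⟩
      have hg : Function.Bijective g := by
        rw [Fintype.bijective_iff_injective_and_card]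
        refine ⟨fun c d h => ?_, by simp [YoungDiagram.card]⟩
        exact Subtype.ext (hf.injOn c.2 d.2 (congrArg Fin.val h))
      refine ⟨⟨Equiv.ofBijective g hg, fun c d => hf.row_lt c c.2 d d.2,
        fun c d => hf.col_lt c c.2 d d.2⟩, ?_⟩
      apply Subtype.ext
      funext c
      by_cases hc : c ∈ la.cells
      · exact StandardTableau.filling_of_mem _ hc
      · exact (dif_neg hc).trans (hf.zero c hc).symm

instance (la : YoungDiagram) : Finite (StandardTableau la) := by
  refine Finite.of_injective (fun t : StandardTableau la => t.entry) ?_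
  rintro ⟨e, h1, h2⟩ ⟨e', h1', h2'⟩ h
  dsimp only at h
  subst h
  rfl

instance (la : YoungDiagram) : Finite {f // IsFilling la f} :=
  Finite.of_equiv _ (tableauEquiv la)

theorem dim_eq_card_filling (la : YoungDiagram) : dim la = Nat.card {f // IsFilling la f} :=
  Nat.card_congr (tableauEquiv la)

theorem dim_bot : dim ⊥ = 1 := by
  rw [dim_eq_card_filling, Nat.card_eq_one_iff_unique]
  refine ⟨⟨?_⟩, ⟨⟨fun _ => 0, by constructor <;> simp⟩⟩⟩
  rintro ⟨f, hf⟩ ⟨g, hg⟩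
  apply Subtype.ext
  funext c
  change f c = g c
  rw [hf.zero c (by simp), hg.zero c (by simp)]

/-- The largest entry goes into the corner; it is $|\lambda|-1$ because entries are numbered from
zero. -/
theorem isFilling_update {la : YoungDiagram} {c : ℕ × ℕ} (hc : c ∈ removable la) {g : ℕ × ℕ → ℕ}
    (hg : IsFilling (removeBox la c) g) :
    IsFilling la (Function.update g c (la.card - 1)) := by
  have hcard := card_removeBox hc
  have hcells := cells_removeBox hc
  have hmem : ∀ d ∈ la.cells, d ≠ c → d ∈ (removeBox la c).cells := fun d hd h => by
    rw [hcells]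
    exact mem_erase.2 ⟨h, hd⟩
  have hlt : ∀ d ∈ la.cells, d ≠ c → g d < la.card - 1 := fun d hd h => by
    have := hg.lt_card d (hmem d hd h)
    omega
  obtain ⟨hr1, hr2⟩ := mem_removable_iff.1 hc
  constructor
  · intro d hd
    have : d ≠ c := fun h => hd (h ▸ (mem_removable.1 hc).1)
    rw [Function.update_of_ne this]
    apply hg.zero
    rw [hcells]
    exact fun h => hd (mem_of_mem_erase h)
  · intro d hd
    by_cases h : d = c
    · rw [h, Function.update_self]; omega
    · rw [Function.update_of_ne h]
      have := hlt d hd h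
      omega
  · intro d hd e he h
    by_cases h1 : d = c <;> by_cases h2 : e = c
    · rw [h1, h2]
    · rw [h1, Function.update_self, Function.update_of_ne h2] at h
      have := hlt e he h2
      omega
    · rw [h2, Function.update_self, Function.update_of_ne h1] at h
      have := hlt d hd h1
      omega
    · rw [Function.update_of_ne h1, Function.update_of_ne h2] at h
      exact hg.injOn (hmem d hd h1) (hmem e he h2) h
  · intro d hd e he h h'
    have h1 : d ≠ c := by
      rintro rfl
      have := mem_cells_iff.1 (show (e.1, e.2) ∈ la.cells from he)
      rw [← h] at this
      omega
    rw [Function.update_of_ne h1]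
    by_cases h2 : e = c
    · rw [h2, Function.update_self]
      exact hlt d hd h1
    · rw [Function.update_of_ne h2]
      exact hg.row_lt d (hmem d hd h1) e (hmem e he h2) h h'
  · intro d hd e he h h'
    have h1 : d ≠ c := by
      rintro rfl
      have := mem_cells_iff.1 (show (e.1, e.2) ∈ la.cells from he)
      have := la.rowLen_anti (d.1 + 1) e.1 h'
      omega
    rw [Function.update_of_ne h1]
    by_cases h2 : e = c
    · rw [h2, Function.update_self]
      exact hlt d hd h1
    · rw [Function.update_of_ne h2]
      exact hg.col_lt d (hmem d hd h1) e (hmem e he h2) h h'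

/-- The box holding the largest entry can have no box to its right or below it. -/
theorem IsFilling.exists_last {la : YoungDiagram} (hla : 0 < la.card) {f : ℕ × ℕ → ℕ}
    (hf : IsFilling la f) : ∃ c ∈ removable la, f c = la.card - 1 := by
  have himg : la.cells.image f = range la.card := by
    apply eq_of_subset_of_card_le
    · intro k hk
      obtain ⟨c, hc, rfl⟩ := mem_image.1 hk
      exact mem_range.2 (hf.lt_card c hc)
    · rw [card_image_of_injOn hf.injOn, card_range]
  have hmem : la.card - 1 ∈ la.cells.image f := by
    rw [himg, mem_range]
    omega
  obtain ⟨⟨i, j⟩, hc, hfc⟩ := mem_image.1 hmem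
  refine ⟨(i, j), mem_removable_iff.2 ?_, hfc⟩
  have hj := mem_cells_iff.1 hc
  dsimp only
  have h1 : la.rowLen i ≤ j + 1 := by
    by_contra h
    have hd : (i, j + 1) ∈ la.cells := mem_cells_iff.2 (by omega)
    have e1 := hf.row_lt _ hc _ hd rfl (Nat.lt_succ_self j)
    have e2 := hf.lt_card _ hd
    omega
  have h2 : la.rowLen (i + 1) ≤ j := by
    by_contra h
    have hd : (i + 1, j) ∈ la.cells := mem_cells_iff.2 (by omega)
    have e1 := hf.col_lt _ hc _ hd rfl (Nat.lt_succ_self i)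
    have e2 := hf.lt_card _ hd
    omega
  omega

theorem IsFilling.restrict {la : YoungDiagram} {c : ℕ × ℕ} (hc : c ∈ removable la)
    {f : ℕ × ℕ → ℕ} (hf : IsFilling la f) (hfc : f c = la.card - 1) :
    IsFilling (removeBox la c) (Function.update f c 0) := by
  have hcard := card_removeBox hc
  have hcells := cells_removeBox hc
  have hmem : ∀ d ∈ (removeBox la c).cells, d ≠ c ∧ d ∈ la.cells := fun d hd => by
    rw [hcells] at hd
    exact mem_erase.1 hd
  constructor
  · intro d hd
    by_cases h : d = c
    · rw [h, Function.update_self]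
    · rw [Function.update_of_ne h]
      apply hf.zero
      intro h'
      apply hd
      rw [hcells]
      exact mem_erase.2 ⟨h, h'⟩
  · intro d hd
    obtain ⟨h1, h2⟩ := hmem d hd
    rw [Function.update_of_ne h1]
    have e1 := hf.lt_card d h2
    have e2 : f d ≠ f c := fun h => h1 (hf.injOn h2 (mem_removable.1 hc).1 h)
    omega
  · intro d hd e he h
    obtain ⟨h1, h2⟩ := hmem d hd
    obtain ⟨h3, h4⟩ := hmem e he
    rw [Function.update_of_ne h1, Function.update_of_ne h3] at h
    exact hf.injOn h2 h4 h
  · intro d hd e he h h'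
    obtain ⟨h1, h2⟩ := hmem d hd
    obtain ⟨h3, h4⟩ := hmem e he
    rw [Function.update_of_ne h1, Function.update_of_ne h3]
    exact hf.row_lt d h2 e h4 h h'
  · intro d hd e he h h'
    obtain ⟨h1, h2⟩ := hmem d hd
    obtain ⟨h3, h4⟩ := hmem e he
    rw [Function.update_of_ne h1, Function.update_of_ne h3]
    exact hf.col_lt d h2 e h4 h h'

/-- The branching rule. -/
theorem dim_eq_sum_removable {la : YoungDiagram} (hla : 0 < la.card) :
    dim la = ∑ c ∈ removable la, dim (removeBox la c) := by
  let F : (Σ c : {c // c ∈ removable la}, {g // IsFilling (removeBox la c.1) g}) →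
      {f // IsFilling la f} := fun p => ⟨_, isFilling_update p.1.2 p.2.2⟩
  have hF : Function.Bijective F := by
    constructor
    · rintro ⟨⟨c, hc⟩, ⟨g, hg⟩⟩ ⟨⟨d, hd⟩, ⟨g', hg'⟩⟩ h
      have h := congrArg Subtype.val h
      dsimp only [F] at h
      have hcd : c = d := by
        have hfill := isFilling_update hd hg'
        apply hfill.injOn (mem_removable.1 hc).1 (mem_removable.1 hd).1
        rw [← h, Function.update_self, h, Function.update_self]
      subst hcd
      have hgg : g = g' := by
        funext e
        by_cases he : e = c
        · rw [he, hg.zero c, hg'.zero c] <;> simp [cells_removeBox hc]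
        · have := congrFun h e
          rwa [Function.update_of_ne he, Function.update_of_ne he] at this
      subst hgg
      rfl
    · rintro ⟨f, hf⟩
      obtain ⟨c, hc, hfc⟩ := hf.exists_last hla
      refine ⟨⟨⟨c, hc⟩, ⟨_, hf.restrict hc hfc⟩⟩, ?_⟩
      apply Subtype.ext
      dsimp only [F]
      rw [Function.update_idem, ← hfc, Function.update_eq_self]
  rw [dim_eq_card_filling, ← Nat.card_congr (Equiv.ofBijective F hF), Nat.card_sigma,
    ← sum_coe_sort (removable la) fun c => dim (removeBox la c)]
  exact sum_congr rfl fun c _ => (dim_eq_card_filling _).symm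

/-! ### Adding and removing boxes in determinants of falling factorials -/

/-- The determinant obtained by replacing a row of the matrix of falling factorials, as a linear
function of the new row. -/
def rowDet {N : ℕ} (n : Fin N → ℕ) (x : Fin N → ℂ) (i : Fin N) : (Fin N → ℂ) →ₗ[ℂ] ℂ :=
  (Matrix.detRowAlternating (R := ℂ) (n := Fin N)).toMultilinearMap.toLinearMap (fallMat n x) i

theorem rowDet_apply {N : ℕ} (n : Fin N → ℕ) (x : Fin N → ℂ) (i : Fin N) (v : Fin N → ℂ) :
    rowDet n x i v = ((fallMat n x).updateRow i v).det := rfl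

theorem rowDet_fallPow {N : ℕ} (n : Fin N → ℕ) (x : Fin N → ℂ) (i : Fin N) (m : ℕ) :
    rowDet n x i (fun j => fallPow m (x j)) = fallDet (Function.update n i m) x :=
  fallDet_update_row n x i m

theorem rowDet_fallPow_self {N : ℕ} (n : Fin N → ℕ) (x : Fin N → ℂ) (i : Fin N) :
    rowDet n x i (fun j => fallPow (n i) (x j)) = fallDet n x := by
  rw [rowDet_fallPow, Function.update_eq_self]

theorem sum_rowDet_shift {N : ℕ} (n : Fin N → ℕ) (x : Fin N → ℂ) (w : ℂ → ℂ) (s : ℂ) :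
    ∑ i, rowDet n x i (fun j => w (x j) * fallPow (n i) (x j + s)) =
      ∑ j, w (x j) * fallDet n (Function.update x j (x j + s)) :=
  (sum_mul_fallDet_update n x w s).symm

theorem sum_rowDet_mul {N : ℕ} (n : Fin N → ℕ) (x : Fin N → ℂ) (w : ℂ → ℂ) :
    ∑ i, rowDet n x i (fun j => w (x j) * fallPow (n i) (x j)) =
      (∑ j, w (x j)) * fallDet n x := by
  have := sum_rowDet_shift n x w 0
  simp only [add_zero, Function.update_eq_self] at this
  rw [this, sum_mul]

/-- Since $x(x-1)^{\downarrow n}=x^{\downarrow(n+1)}=(x-n)x^{\downarrow n}$, the altered row $i$ is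
the original one weighted by $x_j-n_i$. -/
theorem sum_mul_fallDet_sub_one {N : ℕ} (n : Fin N → ℕ) (x : Fin N → ℂ) :
    ∑ j, x j * fallDet n (Function.update x j (x j - 1)) =
      (∑ j, x j - ∑ i, (n i : ℂ)) * fallDet n x := by
  have h := sum_rowDet_shift n x id (-1)
  simp only [id_eq, ← sub_eq_add_neg] at h
  rw [← h, sub_mul, ← sum_rowDet_mul n x fun y => y, sum_mul, ← sum_sub_distrib]
  refine sum_congr rfl fun i _ => ?_
  rw [← rowDet_fallPow_self n x i, ← smul_eq_mul, ← map_smul, ← map_sub]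
  congr 1
  funext j
  simp only [Pi.sub_apply, Pi.smul_apply, smul_eq_mul, mul_fallPow_sub_one, fallPow_succ]
  ring

/-- The coordinate of the row of a box of a diagram with `N` rows, when the box is the last one in
its row. -/
def boxCoord (N : ℕ) (c : ℕ × ℕ) : ℂ := ((c.2 + 1 + (N - 1 - c.1) : ℕ) : ℂ)

theorem coords_removeBox {N : ℕ} {la : YoungDiagram} {c : ℕ × ℕ} (hc : c ∈ removable la)
    (hN : c.1 < N) :
    coords N (removeBox la c) =
      Function.update (coords N la) ⟨c.1, hN⟩ (coords N la ⟨c.1, hN⟩ - 1) := by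
  have hr := (mem_removable_iff.1 hc).1
  funext j
  rcases eq_or_ne j ⟨c.1, hN⟩ with rfl | h
  · rw [Function.update_self, coords, coords, shiftRows, shiftRows, rowLen_removeBox hc, if_pos rfl]
    simp only [hr]
    push_cast
    ring
  · rw [Function.update_of_ne h, coords, coords, shiftRows, shiftRows, rowLen_removeBox hc,
      if_neg fun h' => h (Fin.ext h')]

theorem coords_addBox {N : ℕ} {la : YoungDiagram} {c : ℕ × ℕ} (hc : c ∈ addable la)
    (hN : c.1 < N) :
    coords N (addBox la c) =
      Function.update (coords N la) ⟨c.1, hN⟩ (coords N la ⟨c.1, hN⟩ + 1) := by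
  funext j
  rcases eq_or_ne j ⟨c.1, hN⟩ with rfl | h
  · rw [Function.update_self, coords, coords, shiftRows, shiftRows, rowLen_addBox hc, if_pos rfl]
    push_cast
    ring
  · rw [Function.update_of_ne h, coords, coords, shiftRows, shiftRows, rowLen_addBox hc,
      if_neg fun h' => h (Fin.ext h')]

theorem row_lt_of_mem_removable {N : ℕ} {la : YoungDiagram} {c : ℕ × ℕ} (hc : c ∈ removable la)
    (hN : la.colLen 0 ≤ N) : c.1 < N := by
  by_contra h
  have h2 := (mem_removable_iff.1 hc).2
  have h3 : la.rowLen c.1 = 0 := rowLen_eq_zero_iff.2 (by omega)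
  omega

theorem row_lt_of_mem_addable {N : ℕ} {la : YoungDiagram} {c : ℕ × ℕ} (hc : c ∈ addable la)
    (hN : la.colLen 0 < N) : c.1 < N := by
  by_contra h
  have h2 := (mem_addable_iff.1 hc).2 (la.colLen 0) (by omega)
  have h3 : la.rowLen (la.colLen 0) = 0 := rowLen_eq_zero_iff.2 le_rfl
  omega

/-- Only the rows from which a box can be removed contribute to the sum over the variables. -/
theorem sum_removable_fallDet {N : ℕ} {la : YoungDiagram} (hN : la.colLen 0 ≤ N)
    (n : Fin N → ℕ) :
    ∑ c ∈ removable la, boxCoord N c * fallDet n (coords N (removeBox la c)) =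
      ∑ j, coords N la j * fallDet n (Function.update (coords N la) j (coords N la j - 1)) := by
  rw [sum_removable hN (g := fun i => if h : i < N then coords N la ⟨i, h⟩ * fallDet n
    (Function.update (coords N la) ⟨i, h⟩ (coords N la ⟨i, h⟩ - 1)) else 0),
    ← Fin.sum_univ_eq_sum_range (fun i => if h : i < N then coords N la ⟨i, h⟩ * fallDet n
    (Function.update (coords N la) ⟨i, h⟩ (coords N la ⟨i, h⟩ - 1)) else 0)]
  · simp
  · intro i hi h
    have hc : (i, la.rowLen i - 1) ∈ removable la :=
      mem_removable_iff.2 ⟨by dsimp only; omega, h⟩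
    rw [dif_pos hi, coords_removeBox hc hi]
    congr 1
    rw [coords, shiftRows, boxCoord]
    congr 1
    dsimp only
    omega
  -- When the next row has the same length, lowering this coordinate produces two equal columns. If
  -- this is row $N-1$, its length is zero and the weight $x_{N-1}$ vanishes.
  · intro i hi h
    rw [dif_pos hi]
    by_cases hi' : i + 1 < N
    · rw [fallDet_eq_zero_of_column (i := ⟨i, hi⟩) (j := ⟨i + 1, hi'⟩), mul_zero]
      · simp
      · rw [Function.update_self, Function.update_of_ne (by simp)]
        rw [coords, coords, shiftRows, shiftRows, sub_eq_iff_eq_add, ← Nat.cast_add_one]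
        congr 1
        dsimp only
        omega
    · have h0 : la.rowLen (i + 1) = 0 := rowLen_eq_zero_iff.2 (by omega)
      have : coords N la ⟨i, hi⟩ = 0 := by
        rw [coords, shiftRows, Nat.cast_eq_zero]
        dsimp only
        omega
      rw [this, zero_mul]

theorem sum_addable_fallDet {N : ℕ} {la : YoungDiagram} (hN : la.colLen 0 < N)
    (n : Fin N → ℕ) (w : ℂ → ℂ) :
    ∑ c ∈ addable la, w (boxCoord N c - 1) * fallDet n (coords N (addBox la c)) =
      ∑ j, w (coords N la j) *
        fallDet n (Function.update (coords N la) j (coords N la j + 1)) := by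
  rw [sum_addable hN (g := fun i => if h : i < N then w (coords N la ⟨i, h⟩) * fallDet n
    (Function.update (coords N la) ⟨i, h⟩ (coords N la ⟨i, h⟩ + 1)) else 0),
    ← Fin.sum_univ_eq_sum_range (fun i => if h : i < N then w (coords N la ⟨i, h⟩) * fallDet n
    (Function.update (coords N la) ⟨i, h⟩ (coords N la ⟨i, h⟩ + 1)) else 0)]
  · simp
  · intro i hi hc
    rw [dif_pos hi, coords_addBox hc hi]
    congr 2
    rw [coords, shiftRows, boxCoord]
    push_cast
    ring
  -- The row above has the same length, so the raised coordinate coincides with that of row $i-1$.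
  · intro i hi h
    rw [dif_pos hi]
    have hex : ∃ a < i, la.rowLen a ≤ la.rowLen i := by
      by_contra hne
      push Not at hne
      exact h (mem_addable_iff.2 ⟨rfl, hne⟩)
    obtain ⟨a, ha, ha'⟩ := hex
    have h1 := la.rowLen_anti a (i - 1) (by omega)
    have h2 := la.rowLen_anti (i - 1) i (by omega)
    have hi' : i - 1 < N := by omega
    rw [fallDet_eq_zero_of_column (i := ⟨i, hi⟩) (j := ⟨i - 1, hi'⟩), mul_zero]
    · simp only [ne_eq, Fin.mk.injEq]
      omega
    · rw [Function.update_self, Function.update_of_ne (by simp only [ne_eq, Fin.mk.injEq]; omega)]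
      rw [coords, coords, shiftRows, shiftRows, ← Nat.cast_add_one]
      congr 1
      dsimp only
      omega

theorem sum_shiftRows {N : ℕ} {la : YoungDiagram} (hN : la.colLen 0 ≤ N) :
    ∑ i, (shiftRows N la.rowLen i : ℂ) = la.card + ∑ i ∈ range N, ((N - 1 - i : ℕ) : ℂ) := by
  rw [card_eq_sum_rowLen hN, Nat.cast_sum, ← sum_add_distrib,
    ← Fin.sum_univ_eq_sum_range (fun i => (la.rowLen i : ℂ) + ((N - 1 - i : ℕ) : ℂ))]
  exact sum_congr rfl fun i _ => Nat.cast_add _ _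

theorem sum_coords {N : ℕ} {la : YoungDiagram} (hN : la.colLen 0 ≤ N) :
    ∑ i, coords N la i = la.card + ∑ i ∈ range N, ((N - 1 - i : ℕ) : ℂ) := sum_shiftRows hN

/-- The contributions $\sum_i(N-1-i)$ to $\sum x_j$ and $\sum n_i$ cancel, leaving the difference of
the numbers of boxes. -/
theorem down_fallDet {N : ℕ} {nu la : YoungDiagram} (hn : nu.colLen 0 ≤ N)
    (hl : la.colLen 0 ≤ N) :
    ∑ c ∈ removable la, boxCoord N c *
      fallDet (shiftRows N nu.rowLen) (coords N (removeBox la c)) =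
      ((la.card : ℂ) - nu.card) * fallDet (shiftRows N nu.rowLen) (coords N la) := by
  rw [sum_removable_fallDet hl, sum_mul_fallDet_sub_one, sum_coords hl, sum_shiftRows hn]
  ring

/-- The case $\nu=\varnothing$, which supplies the recurrence matching the branching rule for `dim`.
-/
theorem down_vandermondeProd {N : ℕ} {la : YoungDiagram} (hl : la.colLen 0 ≤ N) :
    ∑ c ∈ removable la, boxCoord N c * vandermondeProd (coords N (removeBox la c)) =
      (la.card : ℂ) * vandermondeProd (coords N la) := by
  have := down_fallDet (nu := ⊥) (by simp) hl
  rw [show (⊥ : YoungDiagram).rowLen = fun _ => 0 from funext rowLen_bot] at this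
  simpa only [fallDet_shiftRows_zero, YoungDiagram.card, cells_bot, card_empty, Nat.cast_zero,
    sub_zero] using this

/-! ### The dimension formula and the coherence relation. -/

/-- The product of the factorials of the coordinates. -/
def coordFactorial (N : ℕ) (la : YoungDiagram) : ℂ :=
  ∏ j, ((shiftRows N la.rowLen j).factorial : ℂ)

theorem coordFactorial_ne_zero (N : ℕ) (la : YoungDiagram) : coordFactorial N la ≠ 0 :=
  prod_ne_zero_iff.2 fun _ _ => Nat.cast_ne_zero.2 (Nat.factorial_ne_zero _)

theorem coordFactorial_removeBox {N : ℕ} {la : YoungDiagram} (hl : la.colLen 0 ≤ N) {c : ℕ × ℕ}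
    (hc : c ∈ removable la) :
    coordFactorial N la = boxCoord N c * coordFactorial N (removeBox la c) := by
  have hN := row_lt_of_mem_removable hc hl
  have hr := (mem_removable_iff.1 hc).1
  rw [coordFactorial, coordFactorial, ← mul_prod_erase univ _ (mem_univ (⟨c.1, hN⟩ : Fin N)),
    ← mul_prod_erase univ _ (mem_univ (⟨c.1, hN⟩ : Fin N)), ← mul_assoc]
  congr 1
  · rw [shiftRows, shiftRows, rowLen_removeBox hc, if_pos rfl, boxCoord]
    dsimp only
    rw [hr, ← Nat.cast_mul, Nat.cast_inj, add_tsub_cancel_right, Nat.add_right_comm,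
      Nat.factorial_succ]
  · refine prod_congr rfl fun j hj => ?_
    have : (j : ℕ) ≠ c.1 := fun h => (mem_erase.1 hj).1 (Fin.ext h)
    rw [shiftRows, shiftRows, rowLen_removeBox hc, if_neg this]

theorem coordFactorial_bot (N : ℕ) :
    coordFactorial N ⊥ = vandermondeProd (coords N ⊥) := by
  induction N with
  | zero => simp [coordFactorial, vandermondeProd]
  | succ N ih =>
    rw [← fallDet_shiftRows_zero, fallDet_coords_succ rfl (by simp), fallDet_shiftRows_zero, ← ih,
      coordFactorial, coordFactorial, Fin.prod_univ_castSucc, shiftRows_last, rowLen_bot,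
      ← prod_mul_distrib, Nat.factorial_zero, Nat.cast_one, mul_one]
    refine prod_congr rfl fun j _ => ?_
    rw [shiftRows_castSucc, Nat.factorial_succ, coords]
    push_cast
    ring

/-- The number of standard tableaux in terms of the shifted row lengths. -/
theorem dim_mul_coordFactorial {N : ℕ} {la : YoungDiagram} (hl : la.colLen 0 ≤ N) :
    (dim la : ℂ) * coordFactorial N la =
      (la.card.factorial : ℂ) * vandermondeProd (coords N la) := by
  induction hk : la.card generalizing la with
  | zero =>
    rw [eq_bot_of_card_eq_zero hk, dim_bot, coordFactorial_bot]
    simp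
  | succ k ih =>
    -- The branching rule and `down_vandermondeProd` are the same recurrence, once removal of a box
    -- is seen to divide $\prod_j x_j!$ by the coordinate of that box.
    rw [dim_eq_sum_removable (by omega), Nat.cast_sum, sum_mul, Nat.factorial_succ, Nat.cast_mul,
      mul_right_comm, ← hk, ← down_vandermondeProd hl, sum_mul]
    refine sum_congr rfl fun c hc => ?_
    rw [coordFactorial_removeBox hl hc, mul_left_comm,
      ih (colLen_removeBox_le hc hl) (by have := card_removeBox hc; omega)]
    ring

theorem dim_ne_zero (la : YoungDiagram) : (dim la : ℂ) ≠ 0 := by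
  have h := dim_mul_coordFactorial (le_refl (la.colLen 0))
  intro h0
  rw [h0, zero_mul, eq_comm, mul_eq_zero] at h
  rcases h with h | h
  · exact Nat.factorial_ne_zero _ (Nat.cast_eq_zero.1 h)
  · exact vandermondeProd_coords_ne_zero _ _ h

theorem boxCoord_ne_zero (N : ℕ) (c : ℕ × ℕ) : boxCoord N c ≠ 0 := by
  rw [boxCoord, Nat.cast_ne_zero]
  omega

/-- The quotient of the dimension formulas for $\lambda\setminus\square$ and $\lambda$; its
Vandermonde factors cancel the denominators of the shifted Schur functions. -/
theorem dim_removeBox_div {N : ℕ} {la : YoungDiagram} (hl : la.colLen 0 ≤ N) {c : ℕ × ℕ}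
    (hc : c ∈ removable la) :
    (la.card : ℂ) * dim (removeBox la c) / dim la =
      boxCoord N c * vandermondeProd (coords N (removeBox la c)) / vandermondeProd (coords N la) := by
  have h1 := dim_mul_coordFactorial hl
  have h2 := dim_mul_coordFactorial (colLen_removeBox_le hc hl)
  rw [coordFactorial_removeBox hl hc] at h1
  rw [div_eq_div_iff (dim_ne_zero la) (vandermondeProd_coords_ne_zero N la)]
  have hf := coordFactorial_ne_zero N (removeBox la c)
  rw [← card_removeBox hc, Nat.factorial_succ] at h1
  rw [← card_removeBox hc]
  have hk : ((removeBox la c).card.factorial : ℂ) ≠ 0 := Nat.cast_ne_zero.2 (Nat.factorial_ne_zero _)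
  apply mul_right_cancel₀ (mul_ne_zero hf hk)
  push_cast at h1 ⊢
  linear_combination (-(dim (removeBox la c) : ℂ) * coordFactorial N (removeBox la c)) * h1 +
    (boxCoord N c * dim la * coordFactorial N (removeBox la c)) * h2

theorem mem_removable_addBox {la : YoungDiagram} {c : ℕ × ℕ} (hc : c ∈ addable la) :
    c ∈ removable (addBox la c) := by
  rw [mem_removable, cells_addBox hc]
  refine ⟨mem_insert_self _ _, ?_⟩
  rw [erase_insert (mem_addable.1 hc).1]
  exact la.isLowerSet

theorem removeBox_addBox {la : YoungDiagram} {c : ℕ × ℕ} (hc : c ∈ addable la) :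
    removeBox (addBox la c) c = la := by
  ext1
  rw [cells_removeBox (mem_removable_addBox hc), cells_addBox hc,
    erase_insert (mem_addable.1 hc).1]

/-- The removal formula for $\lambda\cup\square$, inverted. -/
theorem dim_addBox_div {N : ℕ} {la : YoungDiagram} (hl : la.colLen 0 < N) {c : ℕ × ℕ}
    (hc : c ∈ addable la) :
    (dim (addBox la c) : ℂ) / (((la.card : ℂ) + 1) * dim la) =
      vandermondeProd (coords N (addBox la c)) / (boxCoord N c * vandermondeProd (coords N la)) := by
  have h := dim_removeBox_div (colLen_addBox_le hc hl) (mem_removable_addBox hc)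
  rw [removeBox_addBox hc, card_addBox hc] at h
  rw [← inv_inj, inv_div, inv_div, ← h]
  push_cast
  ring

/-- The coherence relation for the shifted Schur functions. -/
theorem sum_removable_shiftedSchurFun (nu la : YoungDiagram) :
    ∑ c ∈ removable la, (la.card : ℂ) * dim (removeBox la c) / dim la *
      shiftedSchurFun nu (removeBox la c) = ((la.card : ℂ) - nu.card) * shiftedSchurFun nu la := by
  set N := max (nu.colLen 0) (la.colLen 0)
  have hn : nu.colLen 0 ≤ N := le_max_left _ _
  have hl : la.colLen 0 ≤ N := le_max_right _ _
  apply mul_right_cancel₀ (vandermondeProd_coords_ne_zero N la)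
  rw [mul_assoc, shiftedSchurFun_mul hn hl, ← down_fallDet hn hl, sum_mul]
  refine sum_congr rfl fun c hc => ?_
  rw [dim_removeBox_div hl hc, ← shiftedSchurFun_mul hn (colLen_removeBox_le hc hl)]
  field_simp [vandermondeProd_coords_ne_zero N la]

/-! ### The sum over the addable boxes -/

/-- Only the rows from which a box can be removed contribute to the sum over the rows. -/
theorem sum_removable_index {M : ℕ} {nu : YoungDiagram} (hn : nu.colLen 0 ≤ M) (g : ℂ → ℂ)
    (x : Fin (M + 1) → ℂ) :
    ∑ c ∈ removable nu, g (content c) *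
      fallDet (shiftRows (M + 1) (removeBox nu c).rowLen) x =
    ∑ i : Fin M, g ((shiftRows M nu.rowLen i : ℂ) - M) *
      fallDet (Function.update (shiftRows (M + 1) nu.rowLen) i.castSucc
        (shiftRows M nu.rowLen i)) x := by
  set G : ℕ → ℂ := fun i => if h : i < M then g ((shiftRows M nu.rowLen ⟨i, h⟩ : ℂ) - M) *
      fallDet (Function.update (shiftRows (M + 1) nu.rowLen) (Fin.castSucc ⟨i, h⟩)
        (shiftRows M nu.rowLen ⟨i, h⟩)) x else 0 with hG
  rw [sum_removable hn (g := G), ← Fin.sum_univ_eq_sum_range G]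
  · exact sum_congr rfl fun i _ => dif_pos i.2
  · intro i hi h
    have hc : (i, nu.rowLen i - 1) ∈ removable nu :=
      mem_removable_iff.2 ⟨by dsimp only; omega, h⟩
    rw [hG]
    dsimp only
    rw [dif_pos hi]
    congr 2
    -- The last box of row $i$ has content $\nu_i-1-i=(\nu_i+M-1-i)-M$. With $M+1$ variables,
    -- removing it lowers the order from `shiftRows M nu.rowLen i + 1` to `shiftRows M nu.rowLen i`.
    · rw [sub_eq_iff_eq_add, shiftRows, content]
      dsimp only
      rw [← Int.cast_natCast M, ← Int.cast_add, ← Int.cast_natCast, Int.cast_inj]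
      omega
    · funext j
      rcases eq_or_ne j (Fin.castSucc ⟨i, hi⟩) with rfl | hj
      · rw [Function.update_self, shiftRows, shiftRows, rowLen_removeBox hc]
        simp only [Fin.val_castSucc, if_true]
        omega
      · rw [Function.update_of_ne hj, shiftRows, shiftRows, rowLen_removeBox hc, if_neg]
        exact fun h' => hj (Fin.ext h')
  · intro i hi h
    rw [hG]
    dsimp only
    rw [dif_pos hi, fallDet_eq_zero_of_row (i := Fin.castSucc ⟨i, hi⟩) (j := Fin.succ ⟨i, hi⟩),
      mul_zero]
    · simp [Fin.ext_iff]
    · rw [Function.update_self, Function.update_of_ne (by simp [Fin.ext_iff])]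
      simp only [shiftRows, Fin.val_succ, h]
      omega

theorem mul_rowDet {N : ℕ} (n : Fin N → ℕ) (x : Fin N → ℂ) (i : Fin N) (c : ℂ) (v : Fin N → ℂ) :
    c * rowDet n x i v = rowDet n x i fun j => c * v j :=
  ((rowDet n x i).map_smul c v).symm

/-- The rows other than the last have positive order and vanish at the zero coordinate, so the whole
last column is zero. -/
theorem rowDet_last_eq_zero {M : ℕ} (a : ℕ → ℕ) {x : Fin (M + 1) → ℂ} (hx : x (Fin.last M) = 0)
    {v : Fin (M + 1) → ℂ} (hv : v (Fin.last M) = 0) :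
    rowDet (shiftRows (M + 1) a) x (Fin.last M) v = 0 := by
  rw [rowDet_apply]
  apply Matrix.det_eq_zero_of_column_eq_zero (Fin.last M)
  intro i
  refine Fin.lastCases ?_ (fun i => ?_) i
  · rw [Matrix.updateRow_self, hv]
  · rw [Matrix.updateRow_ne (Fin.castSucc_lt_last i).ne]
    simp [fallMat, shiftRows_castSucc, hx, fallPow_succ_zero]

/-- The original last row consists of ones. Subtracting its multiple by `v (Fin.last M)` from `v`
reduces to a vector with vanishing last entry. This handles the order-zero row, where division by
$y+1$ is not absorbed by a falling factorial. -/
theorem rowDet_last {M : ℕ} {a : ℕ → ℕ} (ha : a M = 0) {x : Fin (M + 1) → ℂ}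
    (hx : x (Fin.last M) = 0) (v : Fin (M + 1) → ℂ) :
    rowDet (shiftRows (M + 1) a) x (Fin.last M) v =
      v (Fin.last M) * fallDet (shiftRows (M + 1) a) x := by
  rw [← rowDet_fallPow_self _ x (Fin.last M), ← smul_eq_mul, ← map_smul, ← sub_eq_zero, ← map_sub]
  apply rowDet_last_eq_zero a hx
  simp [shiftRows_last, ha]

/-- Here $x^{\downarrow(n+1)}=(x-n)x^{\downarrow n}$, and omitting the last row costs nothing: its
order is zero, and its weighted version vanishes at the zero coordinate. -/
theorem sum_rowDet_fallPow_succ {M : ℕ} {a : ℕ → ℕ} (ha : a M = 0) {x : Fin (M + 1) → ℂ}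
    (hx : x (Fin.last M) = 0) :
    ∑ i : Fin M, rowDet (shiftRows (M + 1) a) x i.castSucc
        (fun j => fallPow (shiftRows (M + 1) a i.castSucc + 1) (x j)) =
      (∑ j, x j - ∑ i, (shiftRows (M + 1) a i : ℂ)) * fallDet (shiftRows (M + 1) a) x := by
  have h := sum_rowDet_mul (shiftRows (M + 1) a) x fun y => y
  rw [Fin.sum_univ_castSucc, rowDet_last_eq_zero a hx (by rw [hx, zero_mul]), add_zero] at h
  rw [sub_mul, ← h, Fin.sum_univ_castSucc (fun i => (shiftRows (M + 1) a i : ℂ)), shiftRows_last,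
    ha, Nat.cast_zero, add_zero, sum_mul, ← sum_sub_distrib]
  refine sum_congr rfl fun i _ => ?_
  rw [← rowDet_fallPow_self (shiftRows (M + 1) a) x i.castSucc, ← smul_eq_mul, ← map_smul, ← map_sub]
  congr 1
  funext j
  simp only [Pi.sub_apply, Pi.smul_apply, smul_eq_mul, fallPow_succ]
  ring

theorem two_mul_sum_range_sub (M : ℕ) :
    2 * ∑ i ∈ range (M + 1), ((M + 1 - 1 - i : ℕ) : ℂ) = M * (M + 1) := by
  have h := sum_range_reflect (fun i => (i : ℂ)) (M + 1)
  rw [h, ← Nat.cast_sum, mul_comm]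
  have := sum_range_id_mul_two (M + 1)
  rw [Nat.add_sub_cancel] at this
  have := congrArg (Nat.cast (R := ℂ)) this
  push_cast at this ⊢
  rw [this]
  ring

/-- One variable more than the bound $M$ on the numbers of rows makes room for a box in a new row
and forces the last coordinate and the last order to be zero. -/
theorem up_fallDet {M : ℕ} {nu la : YoungDiagram} (hn : nu.colLen 0 ≤ M) (hl : la.colLen 0 ≤ M)
    (z z' : ℂ) :
    ∑ c ∈ addable la, (z + content c) * (z' + content c) / boxCoord (M + 1) c *
        fallDet (shiftRows (M + 1) nu.rowLen) (coords (M + 1) (addBox la c)) =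
      ((la.card : ℂ) + nu.card + z * z') *
          fallDet (shiftRows (M + 1) nu.rowLen) (coords (M + 1) la) +
        ∑ c ∈ removable nu, (z + content c) * (z' + content c) *
          fallDet (shiftRows (M + 1) (removeBox nu c).rowLen) (coords (M + 1) la) := by
  have hnM : nu.rowLen M = 0 := rowLen_eq_zero_iff.2 hn
  have hx := coords_last hl
  rw [sum_removable_index hn fun y => (z + y) * (z' + y)]
  -- A box added to a row with coordinate $y$ has content $y-M$ and changes the coordinate to $y+1$.
  have hL := sum_addable_fallDet (N := M + 1) (Nat.lt_succ_of_le hl) (shiftRows (M + 1) nu.rowLen)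
    fun y => (z + (y - M)) * (z' + (y - M)) / (y + 1)
  rw [← sum_rowDet_shift _ _ fun y => (z + (y - M)) * (z' + (y - M)) / (y + 1), Fin.sum_univ_castSucc, rowDet_last hnM hx, hx, shiftRows_last, hnM] at hL
  -- Let $m+1$ be the order of the row. As $(y+1)^{\downarrow(m+1)}=(y+1)y^{\downarrow m}$, the
  -- denominator cancels, and $(z+y-M)(z'+y-M)y^{\downarrow m}$ is expanded in
  -- $y^{\downarrow(m+2)}$, $y^{\downarrow(m+1)}$, $y^{\downarrow m}$. The last term produces the
  -- sum over $\nu^-$.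
  have hterm : ∀ i : Fin M, rowDet (shiftRows (M + 1) nu.rowLen) (coords (M + 1) la) i.castSucc
      (fun j => (z + (coords (M + 1) la j - M)) * (z' + (coords (M + 1) la j - M)) /
        (coords (M + 1) la j + 1) *
        fallPow (shiftRows (M + 1) nu.rowLen i.castSucc) (coords (M + 1) la j + 1)) =
      rowDet (shiftRows (M + 1) nu.rowLen) (coords (M + 1) la) i.castSucc
        (fun j => fallPow (shiftRows (M + 1) nu.rowLen i.castSucc + 1) (coords (M + 1) la j)) +
      ((2 * shiftRows (M + 1) nu.rowLen i.castSucc - 1 - 2 * M + z + z') *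
        fallDet (shiftRows (M + 1) nu.rowLen) (coords (M + 1) la) +
      (z + ((shiftRows M nu.rowLen i : ℂ) - M)) * (z' + ((shiftRows M nu.rowLen i : ℂ) - M)) *
        fallDet (Function.update (shiftRows (M + 1) nu.rowLen) i.castSucc
          (shiftRows M nu.rowLen i)) (coords (M + 1) la)) := by
    intro i
    rw [← rowDet_fallPow, ← rowDet_fallPow_self _ _ i.castSucc, mul_rowDet, mul_rowDet,
      ← map_add, ← map_add]
    congr 1
    funext j
    have h0 := coords_add_one_ne_zero (M + 1) la j
    simp only [Pi.add_apply, shiftRows_castSucc, fallPow_succ_add_one]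
    rw [fallPow_succ, fallPow_succ]
    push_cast
    field_simp
    ring
  rw [sum_congr rfl fun i _ => hterm i, sum_add_distrib, sum_add_distrib,
    sum_rowDet_fallPow_succ hnM hx, ← sum_mul, sum_coords (by omega), sum_shiftRows (by omega)] at hL
  have hsum : ∑ i : Fin M, (2 * (shiftRows (M + 1) nu.rowLen i.castSucc : ℂ) - 1 - 2 * M + z + z') =
      2 * ((nu.card : ℂ) + ∑ i ∈ range (M + 1), ((M + 1 - 1 - i : ℕ) : ℂ)) +
        M * (- 1 - 2 * M + z + z') := by
    have := sum_shiftRows (show nu.colLen 0 ≤ M + 1 by omega)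
    rw [Fin.sum_univ_castSucc, shiftRows_last, hnM, Nat.cast_zero, add_zero] at this
    rw [← this, mul_sum]
    simp only [sub_eq_add_neg, add_assoc, sum_add_distrib, sum_const, card_univ, Fintype.card_fin,
      nsmul_eq_mul]
    ring
  rw [hsum, fallPow_zero] at hL
  have hLHS : ∀ c ∈ addable la, (z + content c) * (z' + content c) / boxCoord (M + 1) c *
        fallDet (shiftRows (M + 1) nu.rowLen) (coords (M + 1) (addBox la c)) =
      (z + (boxCoord (M + 1) c - 1 - M)) * (z' + (boxCoord (M + 1) c - 1 - M)) /
        (boxCoord (M + 1) c - 1 + 1) *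
        fallDet (shiftRows (M + 1) nu.rowLen) (coords (M + 1) (addBox la c)) := by
    intro c hc
    have hlt := row_lt_of_mem_addable hc (Nat.lt_succ_of_le hl)
    have : (content c : ℂ) = boxCoord (M + 1) c - 1 - M := by
      have h : content c + (1 + M) = ((c.2 + 1 + (M + 1 - 1 - c.1) : ℕ) : ℤ) := by
        rw [content]
        omega
      rw [boxCoord, sub_sub, eq_sub_iff_add_eq]
      exact_mod_cast congrArg (Int.cast (R := ℂ)) h
    rw [this, sub_add_cancel]
  rw [sum_congr rfl hLHS, hL]
  -- The scalar coefficient is $(|\lambda|-|\nu|)+2|\nu|+2\sum_{i\le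
  -- M}(M-i)-M(2M+1)+M(z+z')+(z-M)(z'-M)$. Since the doubled sum is $M(M+1)$, all dependence on $M$
  -- cancels.
  have h2 := two_mul_sum_range_sub M
  linear_combination fallDet (shiftRows (M + 1) nu.rowLen) (coords (M + 1) la) * h2

theorem sum_addable_shiftedSchurFun (nu la : YoungDiagram) (z z' : ℂ) :
    ∑ c ∈ addable la, (z + content c) * (z' + content c) *
        ((dim (addBox la c) : ℂ) / (((la.card : ℂ) + 1) * dim la)) *
        shiftedSchurFun nu (addBox la c) =
      ((la.card : ℂ) + nu.card + z * z') * shiftedSchurFun nu la +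
        ∑ c ∈ removable nu, (z + content c) * (z' + content c) *
          shiftedSchurFun (removeBox nu c) la := by
  set M := max (nu.colLen 0) (la.colLen 0)
  have hn : nu.colLen 0 ≤ M := le_max_left _ _
  have hl : la.colLen 0 ≤ M := le_max_right _ _
  have hV := vandermondeProd_coords_ne_zero (M + 1) la
  apply mul_right_cancel₀ hV
  rw [add_mul _ _ (vandermondeProd _), mul_assoc _ _ (vandermondeProd _), shiftedSchurFun_mul (hn.trans M.le_succ) (hl.trans M.le_succ), sum_mul,
    sum_mul]
  have h := up_fallDet hn hl z z'
  have h1 : ∀ c ∈ removable nu, (z + content c) * (z' + content c) *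
      shiftedSchurFun (removeBox nu c) la * vandermondeProd (coords (M + 1) la) =
      (z + content c) * (z' + content c) *
          fallDet (shiftRows (M + 1) (removeBox nu c).rowLen) (coords (M + 1) la) := by
    intro c hc
    rw [mul_assoc, shiftedSchurFun_mul (colLen_removeBox_le hc (hn.trans M.le_succ))
      (hl.trans M.le_succ)]
  rw [sum_congr rfl h1, ← h]
  refine sum_congr rfl fun c hc => ?_
  have hb := boxCoord_ne_zero (M + 1) c
  rw [dim_addBox_div (Nat.lt_succ_of_le hl) hc,
    ← shiftedSchurFun_mul (hn.trans M.le_succ) (colLen_addBox_le hc (Nat.lt_succ_of_le hl))]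
  field_simp

/-! ### Multiplication of shifted Schur functions by power sums -/

/-- The span of the shifted Schur functions of degree at most `d`. -/
def schurSpan (d : ℕ) : Submodule ℂ (YoungDiagram → ℂ) :=
  Submodule.span ℂ (shiftedSchurFun '' {nu | nu.card ≤ d})

theorem shiftedSchurFun_mem_schurSpan {nu : YoungDiagram} {d : ℕ} (h : nu.card ≤ d) :
    shiftedSchurFun nu ∈ schurSpan d :=
  Submodule.subset_span ⟨nu, h, rfl⟩

theorem schurSpan_mono {d e : ℕ} (h : d ≤ e) : schurSpan d ≤ schurSpan e :=
  Submodule.span_mono (Set.image_mono fun _ hnu => le_trans hnu h)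

theorem sum_add_of_eq_off_pair {M i : ℕ} (hi : i + 1 < M) {F G : ℕ → ℕ}
    (h : ∀ k, k ≠ i → k ≠ i + 1 → F k = G k) :
    ∑ k ∈ range M, F k + (G i + G (i + 1)) = ∑ k ∈ range M, G k + (F i + F (i + 1)) := by
  have hi1 : i + 1 ∈ (range M).erase i := by simp [hi]
  have hi0 : i ∈ range M := by simp; omega
  rw [← add_sum_erase _ F hi0, ← add_sum_erase _ G hi0, ← add_sum_erase _ F hi1,
    ← add_sum_erase _ G hi1, sum_congr rfl fun k hk => h k ?_ ?_]
  · ring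
  · exact (mem_erase.1 (mem_erase.1 hk).2).1
  · exact (mem_erase.1 hk).1

/-- Determinants attached to arbitrary sequences of row lengths are, up to the sign, determinants
attached to Young diagrams, or zero. -/
theorem exists_mem_schurSpan_of_rows {d M : ℕ} {a : ℕ → ℕ} (hM : ∀ i, M ≤ i → a i = 0)
    (hd : ∑ i ∈ range M, a i ≤ d) :
    ∃ f ∈ schurSpan d, ∀ (la : YoungDiagram) (N : ℕ), M ≤ N → la.colLen 0 ≤ N →
      f la * vandermondeProd (coords N la) = fallDet (shiftRows N a) (coords N la) := by
  induction hm : ∑ i ∈ range M, i * a i using Nat.strong_induction_on generalizing a with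
  | _ m ih =>
  by_cases hanti : ∀ i, a (i + 1) ≤ a i
  · have ha := antitone_nat_of_succ_le hanti
    have hr : (diagramOfRows a M ha).rowLen = a := funext (rowLen_diagramOfRows ha hM)
    have hc : (diagramOfRows a M ha).colLen 0 ≤ M := by
      rw [← rowLen_eq_zero_iff, hr, hM M le_rfl]
    refine ⟨shiftedSchurFun (diagramOfRows a M ha), shiftedSchurFun_mem_schurSpan ?_, ?_⟩
    · rw [card_eq_sum_rowLen hc, hr]
      exact hd
    · intro la N hN hl
      rw [shiftedSchurFun_mul (hc.trans hN) hl, hr]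
  · push Not at hanti
    obtain ⟨i, hi⟩ := hanti
    have hiM : i + 1 < M := by
      by_contra h
      have := hM (i + 1) (by omega)
      omega
    -- If the ascent is by exactly one, the two orders coincide and the determinant vanishes.
    -- Otherwise interchanging the two orders replaces $(a_i,a_{i+1})$ by $(a_{i+1}-1,a_i+1)$. This
    -- keeps $\sum a_i$ and lowers $\sum i\,a_i$ by $a_{i+1}-a_i-1>0$, so the straightening
    -- terminates.
    rcases (show a i + 1 ≤ a (i + 1) from hi).eq_or_lt with heq | hlt
    · refine ⟨0, Submodule.zero_mem _, fun la N hN _ => ?_⟩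
      rw [fallDet_eq_zero_of_row (i := ⟨i, by omega⟩) (j := ⟨i + 1, by omega⟩)]
      · simp
      · simp
      · simp only [shiftRows]
        omega
    · set a' : ℕ → ℕ := fun k => if k = i then a (i + 1) - 1 else if k = i + 1 then a i + 1 else a k
        with ha'
      have e0 : a' i = a (i + 1) - 1 := if_pos rfl
      have e1 : a' (i + 1) = a i + 1 := by
        rw [ha']
        dsimp only
        rw [if_neg (by omega), if_pos rfl]
      have e2 : ∀ k, k ≠ i → k ≠ i + 1 → a' k = a k := fun k h h' => by
        rw [ha']
        dsimp only
        rw [if_neg h, if_neg h']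
      have s1 := sum_add_of_eq_off_pair hiM e2
      have s2 := sum_add_of_eq_off_pair hiM (F := fun k => k * a' k) (G := fun k => k * a k)
        fun k h h' => by rw [e2 k h h']
      -- This parametrization removes the truncated subtraction before the descent is checked.
      obtain ⟨b, hb⟩ : ∃ b, a (i + 1) = a i + 2 + b := ⟨a (i + 1) - (a i + 2), by omega⟩
      rw [e0, e1] at s1
      rw [e0, e1, hb] at s2
      rw [show a i + 2 + b - 1 = a i + 1 + b by omega] at s2
      obtain ⟨f, hf, hf'⟩ := ih (∑ k ∈ range M, k * a' k) (by rw [← hm]; nlinarith)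
        (a := a') (fun k hk => by rw [e2 k (by omega) (by omega), hM k hk]) (by omega) rfl
      refine ⟨-f, Submodule.neg_mem _ hf, fun la N hN hl => ?_⟩
      have hsw : shiftRows N a = shiftRows N a' ∘
          Equiv.swap (⟨i, by omega⟩ : Fin N) ⟨i + 1, by omega⟩ := by
        funext j
        rw [Function.comp_apply]
        by_cases h0 : j = ⟨i, by omega⟩
        · subst h0
          rw [Equiv.swap_apply_left]
          simp only [shiftRows, e1]
          omega
        · by_cases h1 : j = ⟨i + 1, by omega⟩
          · subst h1
            rw [Equiv.swap_apply_right]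
            simp only [shiftRows, e0]
            omega
          · rw [Equiv.swap_apply_of_ne_of_ne h0 h1, shiftRows, shiftRows, e2]
            · exact fun h => h0 (Fin.ext h)
            · exact fun h => h1 (Fin.ext h)
      rw [hsw, fallDet_comp_swap _ (by simp), ← hf' la N hN hl, Pi.neg_apply, neg_mul]

/-- Iterate $(x-n+u)x^{\downarrow(n+l)}=x^{\downarrow(n+l+1)}+(u+l)x^{\downarrow(n+l)}$. The
coefficients do not depend on $n$; this matters because the orders of the rows depend on the number
of variables, which must be free to grow. -/
theorem exists_pow_mul_fallPow (k : ℕ) (u : ℂ) : ∃ c : ℕ → ℂ, c 0 = u ^ k ∧ (∀ l, k < l → c l = 0) ∧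
    ∀ (n : ℕ) (x : ℂ), (x - n + u) ^ k * fallPow n x =
      ∑ l ∈ range (k + 1), c l * fallPow (n + l) x := by
  induction k with
  | zero =>
    refine ⟨fun l => if l = 0 then 1 else 0, by simp, fun l hl => if_neg (by omega), ?_⟩
    intro n x
    simp
  | succ k ih =>
    obtain ⟨c, h0, hc, h⟩ := ih
    refine ⟨fun l => (if l = 0 then 0 else c (l - 1)) + (u + l) * c l, ?_, ?_, ?_⟩
    · simp [h0, pow_succ, mul_comm]
    · intro l hl
      dsimp only
      rw [if_neg (by omega), hc (l - 1) (by omega), hc l (by omega)]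
      simp
    · intro n x
      rw [pow_succ', mul_assoc, h, mul_sum]
      have e1 : ∑ l ∈ range (k + 2), (if l = 0 then 0 else c (l - 1)) * fallPow (n + l) x =
          ∑ l ∈ range (k + 1), c l * fallPow (n + l + 1) x := by
        rw [sum_range_succ']
        simp [add_assoc]
      have e2 : ∑ l ∈ range (k + 2), (u + l) * c l * fallPow (n + l) x =
          ∑ l ∈ range (k + 1), (u + l) * c l * fallPow (n + l) x := by
        rw [sum_range_succ, hc (k + 1) (by omega)]
        simp
      simp only [add_mul _ _ (fallPow _ _)]
      rw [sum_add_distrib, e1, e2, ← sum_add_distrib]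
      refine sum_congr rfl fun l _ => ?_
      rw [fallPow_succ]
      push_cast
      ring

theorem shiftRows_update {N : ℕ} (a : ℕ → ℕ) (i : Fin N) (l : ℕ) :
    shiftRows N (Function.update a i (a i + l)) =
      Function.update (shiftRows N a) i (shiftRows N a i + l) := by
  funext j
  rcases eq_or_ne j i with rfl | h
  · simp only [shiftRows, Function.update_self]
    omega
  · rw [Function.update_of_ne h, shiftRows, shiftRows,
      Function.update_of_ne fun h' => h (Fin.ext h')]

/-- Lengthening by $l$ an empty row at least $l$ places below the last nonempty one gives it the
order of row $i-l$. Hence the expansion of $p_k FS_\nu$ stops at a row independent of $N$. -/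
theorem fallDet_update_eq_zero {N : ℕ} {nu : YoungDiagram} {i l : ℕ} (hi : i < N) (hl : 0 < l)
    (hil : nu.colLen 0 + l ≤ i) (x : Fin N → ℂ) :
    fallDet (shiftRows N (Function.update nu.rowLen i (nu.rowLen i + l))) x = 0 := by
  apply fallDet_eq_zero_of_row (i := ⟨i, hi⟩) (j := ⟨i - l, by omega⟩)
  · simp only [ne_eq, Fin.mk.injEq]
    omega
  · simp only [shiftRows, Function.update_self]
    rw [Function.update_of_ne (by omega), rowLen_eq_zero_iff.2 (by omega),
      rowLen_eq_zero_iff.2 (by omega)]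
    omega

/-- Multiplication by $\sum_j w(x_j)$ distributes over the rows. With $w(y)=(y-N+1/2)^k$ the weight
is $(\lambda_j-j-1/2)^k$ (rows from zero), and each row is then expanded in falling factorials of
order at least its own. -/
theorem powerFun_mul_fallDet (k : ℕ+) {N : ℕ} {nu la : YoungDiagram} (hn : nu.colLen 0 ≤ N)
    (hl : la.colLen 0 ≤ N) (c : ℕ → ℕ → ℂ)
    (hc0 : ∀ i, c i 0 = ((nu.rowLen i : ℂ) - i - 1 / 2) ^ (k : ℕ))
    (hc : ∀ i (n : ℕ) (x : ℂ), (x - n + ((nu.rowLen i : ℂ) - i - 1 / 2)) ^ (k : ℕ) * fallPow n x =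
      ∑ l ∈ range (k + 1), c i l * fallPow (n + l) x) :
    powerFun k la * fallDet (shiftRows N nu.rowLen) (coords N la) =
      powerFun k nu * fallDet (shiftRows N nu.rowLen) (coords N la) +
      ∑ i ∈ range N, ∑ l ∈ range k, c i (l + 1) *
        fallDet (shiftRows N (Function.update nu.rowLen i (nu.rowLen i + (l + 1))))
          (coords N la) := by
  have h := sum_rowDet_mul (shiftRows N nu.rowLen) (coords N la)
    fun y => (y - N + 1 / 2) ^ (k : ℕ)
  have hcoord : ∀ j : Fin N, coords N la j - N + 1 / 2 = (la.rowLen j : ℂ) - (j : ℕ) - 1 / 2 := by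
    intro j
    have : shiftRows N la.rowLen j + (j + 1) = la.rowLen j + N := by
      simp only [shiftRows]
      omega
    have := congrArg (Nat.cast (R := ℂ)) this
    push_cast at this
    rw [coords]
    linear_combination this
  have hterm : ∀ i : Fin N, rowDet (shiftRows N nu.rowLen) (coords N la) i (fun j =>
      (coords N la j - N + 1 / 2) ^ (k : ℕ) * fallPow (shiftRows N nu.rowLen i) (coords N la j)) =
      ∑ l ∈ range k, c i (l + 1) *
        fallDet (shiftRows N (Function.update nu.rowLen i (nu.rowLen i + (l + 1))))
          (coords N la) + ((nu.rowLen i : ℂ) - (i : ℕ) - 1 / 2) ^ (k : ℕ) *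
          fallDet (shiftRows N nu.rowLen) (coords N la) := by
    intro i
    have hvec : (fun j => (coords N la j - N + 1 / 2) ^ (k : ℕ) *
        fallPow (shiftRows N nu.rowLen i) (coords N la j)) =
        ∑ l ∈ range (k + 1), c i l •
          fun j => fallPow (shiftRows N nu.rowLen i + l) (coords N la j) := by
      funext j
      rw [Finset.sum_apply]
      simp only [Pi.smul_apply, smul_eq_mul]
      rw [← hc]
      congr 2
      have : shiftRows N nu.rowLen i + (i + 1) = nu.rowLen i + N := by
        simp only [shiftRows]
        omega
      have := congrArg (Nat.cast (R := ℂ)) this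
      push_cast at this
      linear_combination this
    rw [hvec, map_sum, sum_range_succ', map_smul, add_zero, rowDet_fallPow_self, hc0, smul_eq_mul]
    congr 1
    refine sum_congr rfl fun l _ => ?_
    rw [map_smul, rowDet_fallPow, shiftRows_update, smul_eq_mul]
  rw [sum_congr rfl fun i _ => hterm i, sum_add_distrib, ← sum_mul] at h
  simp only [hcoord] at h
  rw [powerFun_eq_sum_rows k hl, powerFun_eq_sum_rows k hn, sum_sub_distrib, sum_sub_distrib,
    ← Fin.sum_univ_eq_sum_range (fun i => ((la.rowLen i : ℂ) - i - 1 / 2) ^ (k : ℕ)),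
    ← Fin.sum_univ_eq_sum_range (fun i => ((nu.rowLen i : ℂ) - i - 1 / 2) ^ (k : ℕ)),
    ← Fin.sum_univ_eq_sum_range (fun i => ∑ l ∈ range k, c i (l + 1) *
        fallDet (shiftRows N (Function.update nu.rowLen i (nu.rowLen i + (l + 1))))
          (coords N la))]
  linear_combination -h

theorem powerFun_mul_shiftedSchurFun_mem (k : ℕ+) (nu : YoungDiagram) :
    powerFun k * shiftedSchurFun nu ∈ schurSpan (nu.card + k) := by
  set M := nu.colLen 0 + k with hM
  have hn : nu.colLen 0 ≤ M := Nat.le_add_right _ _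
  choose c hc0 _ hc using fun i : ℕ =>
    exists_pow_mul_fallPow (k : ℕ) ((nu.rowLen i : ℂ) - i - 1 / 2)
  have hrows : ∀ i l : ℕ, ∃ f ∈ schurSpan (nu.card + l), ∀ (la : YoungDiagram) (N : ℕ),
      M + (i + 1) ≤ N + M → M ≤ N → la.colLen 0 ≤ N → f la * vandermondeProd (coords N la) =
        fallDet (shiftRows N (Function.update nu.rowLen i (nu.rowLen i + l))) (coords N la) := by
    intro i l
    obtain ⟨f, hf, hf'⟩ := exists_mem_schurSpan_of_rows (d := nu.card + l) (M := max M (i + 1))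
      (a := Function.update nu.rowLen i (nu.rowLen i + l))
      (fun j hj => by
        rw [Function.update_of_ne (by omega)]
        exact rowLen_eq_zero_iff.2 (by omega))
      (by
        have hi : i ∈ range (max M (i + 1)) := by simp
        rw [card_eq_sum_rowLen (hn.trans (le_max_left M (i + 1))), sum_update_of_mem hi,
          sum_eq_add_sum_sdiff_singleton_of_mem hi nu.rowLen]
        omega)
    exact ⟨f, hf, fun la N h1 h2 h3 => hf' la N (max_le h2 (by omega)) h3⟩
  choose f hf hf' using hrows
  have key : powerFun k * shiftedSchurFun nu = powerFun k nu • shiftedSchurFun nu +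
      ∑ i ∈ range M, ∑ l ∈ range k, c i (l + 1) • f i (l + 1) := by
    funext la
    set N := max M (la.colLen 0)
    have hN : M ≤ N := le_max_left _ _
    have hl : la.colLen 0 ≤ N := le_max_right _ _
    apply mul_right_cancel₀ (vandermondeProd_coords_ne_zero N la)
    simp only [Pi.mul_apply, Pi.add_apply, Pi.smul_apply, smul_eq_mul, Finset.sum_apply]
    rw [mul_assoc, add_mul, mul_assoc, shiftedSchurFun_mul (hn.trans hN) hl,
      powerFun_mul_fallDet k (hn.trans hN) hl c hc0 hc, sum_mul]
    congr 1
    rw [← sum_subset (range_mono hN)]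
    · refine sum_congr rfl fun i hi => ?_
      rw [sum_mul]
      refine sum_congr rfl fun l _ => ?_
      have := mem_range.1 hi
      rw [mul_assoc, hf' i (l + 1) la N (by omega) hN hl]
    · intro i hi hiM
      refine sum_eq_zero fun l hlk => ?_
      have h1 := mem_range.1 hlk
      rw [mem_range] at hi hiM
      rw [fallDet_update_eq_zero hi (Nat.succ_pos l) (by omega), mul_zero]
  rw [key]
  refine Submodule.add_mem _ (Submodule.smul_mem _ _
    (shiftedSchurFun_mem_schurSpan (Nat.le_add_right _ _))) ?_
  refine Submodule.sum_mem _ fun i _ => Submodule.sum_mem _ fun l hl => Submodule.smul_mem _ _ ?_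
  have := mem_range.1 hl
  exact schurSpan_mono (by omega) (hf i (l + 1))

theorem powerFun_mul_mem_schurSpan (k : ℕ+) {d : ℕ} {f : YoungDiagram → ℂ} (hf : f ∈ schurSpan d) :
    powerFun k * f ∈ schurSpan (d + k) := by
  induction hf using Submodule.span_induction with
  | mem f hf =>
    obtain ⟨nu, hnu, rfl⟩ := hf
    exact schurSpan_mono (Nat.add_le_add_right hnu _) (powerFun_mul_shiftedSchurFun_mem k nu)
  | zero => rw [mul_zero]; exact Submodule.zero_mem _
  | add f g _ _ hf hg => rw [mul_add]; exact Submodule.add_mem _ hf hg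
  | smul c f _ hf => rw [mul_smul_comm]; exact Submodule.smul_mem _ _ hf

theorem one_mem_schurSpan : (1 : YoungDiagram → ℂ) ∈ schurSpan 0 := by
  have : (1 : YoungDiagram → ℂ) = shiftedSchurFun ⊥ :=
    funext fun la => (shiftedSchurFun_bot la).symm
  rw [this]
  exact shiftedSchurFun_mem_schurSpan le_rfl

end MeixnerSym

namespace MeixnerSym

open Finset MvPolynomial

/-! ### Power sums generate the symmetric functions freely -/

/-- The kernels of the iterates stabilize. If $f(x)=0$ and $x=f^n(y)$, then $y\in\ker f^{n+1}=\ker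
f^n$, so $x=0$. -/
theorem injective_of_surjective_ringHom {R : Type*} [CommRing R] [IsNoetherianRing R] (f : R →+* R)
    (hf : Function.Surjective f) : Function.Injective f := by
  rw [injective_iff_map_eq_zero]
  intro x hx
  let K : ℕ →o Ideal R := ⟨fun n => RingHom.ker (f ^ n), monotone_nat_of_le_succ fun n y hy => by
    rw [RingHom.mem_ker] at hy ⊢
    rw [pow_succ', RingHom.mul_def, RingHom.comp_apply, hy, map_zero]⟩
  obtain ⟨n, hn⟩ := monotone_stabilizes_iff_noetherian.2 ‹IsNoetherianRing R› K
  have hsurj : Function.Surjective (f ^ n) := by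
    rw [RingHom.coe_pow]
    exact hf.iterate n
  obtain ⟨y, rfl⟩ := hsurj x
  have h1 : y ∈ K (n + 1) := by
    change (f ^ (n + 1)) y = 0
    rwa [pow_succ', RingHom.mul_def, RingHom.comp_apply]
  rw [← hn (n + 1) n.le_succ] at h1
  exact h1

/-- The homomorphism taking the variables to the power sums `p_1, …, p_n` in `n` variables. -/
def psumHom (n : ℕ) : MvPolynomial (Fin n) ℂ →ₐ[ℂ] MvPolynomial (Fin n) ℂ :=
  aeval fun i => psum (Fin n) ℂ (i + 1)

theorem psum_mem_range_psumHom {n k : ℕ} (hk : 0 < k) (hkn : k ≤ n) :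
    psum (Fin n) ℂ k ∈ (psumHom n).range :=
  ⟨X ⟨k - 1, by omega⟩, by
    change psumHom n _ = _
    rw [psumHom, aeval_X]
    dsimp only
    rw [Nat.sub_add_cancel hk]⟩

/-- Newton's identities, with division by $k$ permitted over $\mathbb C$. -/
theorem esymm_mem_range_psumHom {n k : ℕ} (hkn : k ≤ n) :
    esymm (Fin n) ℂ k ∈ (psumHom n).range := by
  induction k using Nat.strong_induction_on with
  | _ k ih =>
  rcases Nat.eq_zero_or_pos k with rfl | hk
  · rw [esymm_zero]
    exact one_mem _
  · have h := mul_esymm_eq_sum (Fin n) ℂ k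
    have hmem : (k : MvPolynomial (Fin n) ℂ) * esymm (Fin n) ℂ k ∈ (psumHom n).range := by
      rw [h]
      refine mul_mem (pow_mem (neg_mem (one_mem _)) _) (sum_mem fun a ha => ?_)
      rw [mem_filter, HasAntidiagonal.mem_antidiagonal] at ha
      exact mul_mem (mul_mem (pow_mem (neg_mem (one_mem _)) _) (ih a.1 ha.2 (by omega)))
        (psum_mem_range_psumHom (by omega) (by omega))
    have h2 := Subalgebra.smul_mem _ hmem ((k : ℂ)⁻¹)
    rwa [← nsmul_eq_mul, ← Nat.cast_smul_eq_nsmul ℂ, smul_smul,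
      inv_mul_cancel₀ (Nat.cast_ne_zero.2 hk.ne'), one_smul] at h2

theorem range_psumHom (n : ℕ) : (psumHom n).range = symmetricSubalgebra (Fin n) ℂ := by
  apply le_antisymm
  · rintro _ ⟨p, rfl⟩
    change psumHom n p ∈ _
    induction p using MvPolynomial.induction_on with
    | C r => rw [← algebraMap_eq, AlgHom.commutes]; exact Subalgebra.algebraMap_mem _ _
    | add p q hp hq => rw [map_add]; exact add_mem hp hq
    | mul_X p i hp =>
      rw [map_mul]
      refine mul_mem hp ?_
      rw [psumHom, aeval_X]
      exact psum_isSymmetric _ _ _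
  · intro p hp
    obtain ⟨q, hq⟩ : ∃ q, ((esymmAlgHom (Fin n) ℂ n q : symmetricSubalgebra (Fin n) ℂ) :
        MvPolynomial (Fin n) ℂ) = p := by
      obtain ⟨q, hq⟩ := esymmAlgHom_surjective ℂ (Fintype.card_fin n).le ⟨p, hp⟩
      exact ⟨q, by rw [hq]⟩
    rw [← hq]
    clear hq hp
    induction q using MvPolynomial.induction_on with
    | C r =>
      rw [← algebraMap_eq, AlgHom.commutes]
      exact Subalgebra.algebraMap_mem _ _
    | add p q hp hq => rw [map_add]; exact add_mem hp hq
    | mul_X p i hp =>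
      rw [map_mul]
      refine mul_mem hp ?_
      rw [esymmAlgHom, aeval_X]
      exact esymm_mem_range_psumHom i.2

/-- The symmetric polynomials are themselves a polynomial ring in $n$ elementary generators. Thus
`psumHom n` becomes a surjective endomorphism of a Noetherian ring. -/
theorem psumHom_injective (n : ℕ) : Function.Injective (psumHom n) := by
  let e := esymmAlgEquiv (Fin n) ℂ (Fintype.card_fin n)
  let g : MvPolynomial (Fin n) ℂ →ₐ[ℂ] symmetricSubalgebra (Fin n) ℂ :=
    (psumHom n).codRestrict _ fun p => by rw [← range_psumHom]; exact ⟨p, rfl⟩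
  have hg : Function.Surjective g := by
    rintro ⟨p, hp⟩
    rw [← range_psumHom] at hp
    obtain ⟨q, hq⟩ := hp
    exact ⟨q, Subtype.ext hq⟩
  have h := injective_of_surjective_ringHom
    ((e.symm : symmetricSubalgebra (Fin n) ℂ →ₐ[ℂ] MvPolynomial (Fin n) ℂ).comp g).toRingHom
    (e.symm.surjective.comp hg)
  intro p q hpq
  apply h
  change e.symm (g p) = e.symm (g q)
  rw [show g p = g q from Subtype.ext hpq]

/-- The index `i + 1` as a positive natural number. -/
def finToPNat (n : ℕ) (i : Fin n) : ℕ+ := ⟨i + 1, Nat.succ_pos _⟩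

theorem finToPNat_injective (n : ℕ) : Function.Injective (finToPNat n) := fun i j h => by
  have := congrArg PNat.val h
  exact Fin.ext (by simpa [finToPNat] using this)

theorem exists_rename_finToPNat (P : MvPolynomial ℕ+ ℂ) :
    ∃ n : ℕ, ∃ Q : MvPolynomial (Fin n) ℂ, rename (finToPNat n) Q = P := by
  refine ⟨P.vars.sup PNat.val, ?_⟩
  apply exists_rename_eq_of_vars_subset_range P _ (finToPNat_injective _)
  intro k hk
  have h1 : (k : ℕ) ≤ P.vars.sup PNat.val := le_sup (f := PNat.val) hk
  have h2 := k.pos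
  refine ⟨⟨(k : ℕ) - 1, by omega⟩, PNat.coe_injective ?_⟩
  change (k : ℕ) - 1 + 1 = k
  omega

/-- The homomorphism taking the variables to the Newton power sums. -/
def powerSumHom : MvPolynomial ℕ+ ℂ →ₐ[ℂ] SymFun := aeval powerSum

/-- The component of a symmetric function in `N` variables. -/
def component (N : ℕ) : SymFun →ₐ[ℂ] MvPolynomial (Fin N) ℂ :=
  (Pi.evalAlgHom ℂ (fun N => MvPolynomial (Fin N) ℂ) N).comp SymFun.val

theorem component_apply (N : ℕ) (F : SymFun) : component N F = (F : ∀ N, MvPolynomial (Fin N) ℂ) N :=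
  rfl

theorem component_powerSumHom (N : ℕ) (P : MvPolynomial ℕ+ ℂ) :
    component N (powerSumHom P) = aeval (fun k : ℕ+ => psum (Fin N) ℂ k) P := by
  have : (component N).comp powerSumHom = aeval fun k : ℕ+ => psum (Fin N) ℂ k := by
    apply algHom_ext
    intro k
    rw [AlgHom.comp_apply, powerSumHom, aeval_X, aeval_X]
    rfl
  exact DFunLike.congr_fun this P

theorem aeval_psum_rename (n : ℕ) (Q : MvPolynomial (Fin n) ℂ) :
    aeval (fun k : ℕ+ => psum (Fin n) ℂ k) (rename (finToPNat n) Q) = psumHom n Q := by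
  rw [aeval_rename]
  rfl

/-- A polynomial relation involves only $p_1,\dots,p_n$ for some $n$, and is already excluded in $n$
variables. -/
theorem powerSumHom_injective : Function.Injective powerSumHom := by
  rw [injective_iff_map_eq_zero]
  intro P hP
  obtain ⟨n, Q, rfl⟩ := exists_rename_finToPNat P
  have h := component_powerSumHom n (rename (finToPNat n) Q)
  rw [hP, map_zero, aeval_psum_rename] at h
  rw [(injective_iff_map_eq_zero _).1 (psumHom_injective n) Q h.symm, map_zero]

/-! ### Degrees, and recovery of a symmetric function from finitely many variables. -/

theorem psum_isHomogeneous (σ : Type*) [Fintype σ] (k : ℕ) : (psum σ ℂ k).IsHomogeneous k :=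
  IsHomogeneous.sum _ _ _ fun i _ => isHomogeneous_X_pow i k

/-- The degree of a monomial in the power sums, the `k`-th variable having weight `k`. -/
def monomialWeight (m : ℕ+ →₀ ℕ) : ℕ := ∑ k ∈ m.support, (k : ℕ) * m k

theorem aeval_psum_monomial_isHomogeneous (N : ℕ) (m : ℕ+ →₀ ℕ) (c : ℂ) :
    (aeval (fun k : ℕ+ => psum (Fin N) ℂ k) (monomial m c)).IsHomogeneous (monomialWeight m) := by
  rw [aeval_monomial, algebraMap_eq, Finsupp.prod]
  exact (IsHomogeneous.prod _ _ _ fun k _ => (psum_isHomogeneous _ _).pow _).C_mul _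

theorem dropLast_rename (N : ℕ) (p : MvPolynomial (Fin N) ℂ) :
    dropLast N (rename Fin.castSucc p) = p := by
  rw [dropLast, aeval_rename]
  have : ((Fin.lastCases 0 fun i => X i : Fin (N + 1) → MvPolynomial (Fin N) ℂ) ∘ Fin.castSucc) =
      X := by
    funext i
    simp
  rw [this, aeval_X_left_apply]

theorem coeff_dropLast (N : ℕ) (p : MvPolynomial (Fin (N + 1)) ℂ) (m : Fin N →₀ ℕ) :
    (dropLast N p).coeff m = p.coeff (m.mapDomain Fin.castSucc) := by
  classical
  induction p using MvPolynomial.induction_on' with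
  | add p q hp hq => rw [map_add, coeff_add, coeff_add, hp, hq]
  | monomial s c =>
    by_cases hs : s (Fin.last N) = 0
    · obtain ⟨t, rfl⟩ : ∃ t : Fin N →₀ ℕ, t.mapDomain Fin.castSucc = s := by
        refine ⟨s.comapDomain Fin.castSucc (Fin.castSucc_injective N).injOn,
          Finsupp.mapDomain_comapDomain _ (Fin.castSucc_injective N) _ ?_⟩
        intro i hi
        rw [mem_coe, Finsupp.mem_support_iff] at hi
        exact Fin.exists_castSucc_eq.2 fun h => hi (h ▸ hs)
      rw [← rename_monomial, dropLast_rename, coeff_rename_mapDomain _ (Fin.castSucc_injective N)]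
    · have h1 : monomial s c = monomial (s - Finsupp.single (Fin.last N) 1) c * X (Fin.last N) := by
        rw [X, monomial_mul, mul_one, tsub_add_cancel_of_le]
        rw [Finsupp.single_le_iff]
        omega
      have h2 : dropLast N (X (Fin.last N)) = 0 := by simp [dropLast]
      nth_rw 1 [h1]
      rw [map_mul, h2, mul_zero, coeff_zero, coeff_monomial, if_neg]
      rintro rfl
      apply hs
      apply Finsupp.mapDomain_of_notMem_range
      rintro ⟨i, hi⟩
      exact (Fin.castSucc_lt_last i).ne hi

/-- A monomial of degree at most $N$ misses one of the $N+1$ variables. By symmetry the missing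
variable may be taken to be the last, and such a coefficient survives `dropLast`. -/
theorem eq_zero_of_dropLast_eq_zero {N : ℕ} {p : MvPolynomial (Fin (N + 1)) ℂ}
    (hp : p.IsSymmetric) (hd : p.totalDegree ≤ N) (h : dropLast N p = 0) : p = 0 := by
  ext m
  rw [coeff_zero]
  by_contra hm
  have hlast : ∀ s : Fin (N + 1) →₀ ℕ, s (Fin.last N) = 0 → p.coeff s = 0 := by
    intro s hs
    have := coeff_dropLast N p (s.comapDomain Fin.castSucc (Fin.castSucc_injective N).injOn)
    rw [h, coeff_zero, Finsupp.mapDomain_comapDomain _ (Fin.castSucc_injective N)] at this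
    · exact this.symm
    · intro i hi
      rw [mem_coe, Finsupp.mem_support_iff] at hi
      exact Fin.exists_castSucc_eq.2 fun h => hi (h ▸ hs)
  obtain ⟨i, hi⟩ : ∃ i, m i = 0 := by
    by_contra hne
    push Not at hne
    have h1 := le_totalDegree (mem_support_iff.2 hm)
    rw [Finsupp.sum_fintype _ _ fun _ => rfl] at h1
    have h2 : ∑ _i : Fin (N + 1), 1 ≤ ∑ i, m i :=
      sum_le_sum fun i _ => Nat.one_le_iff_ne_zero.2 (hne i)
    simp only [sum_const, card_univ, Fintype.card_fin, smul_eq_mul, mul_one] at h2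
    omega
  apply hm
  have h3 := hp (Equiv.swap i (Fin.last N))
  rw [← coeff_rename_mapDomain (Equiv.swap i (Fin.last N)) (Equiv.injective _), h3]
  apply hlast
  rw [Finsupp.mapDomain_equiv_apply, Equiv.symm_swap, Equiv.swap_apply_right, hi]

theorem eq_zero_of_component_eq_zero {F : SymFun} {d : ℕ}
    (hd : ∀ N, (component N F).totalDegree ≤ d) (h : component d F = 0) : F = 0 := by
  obtain ⟨hsym, hdrop, -⟩ := F.2
  have hle : ∀ N, N ≤ d → component N F = 0 := fun N hN => by
    induction hN using Nat.decreasingInduction with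
    | self => exact h
    | of_succ k _ ih =>
      rw [component_apply] at ih ⊢
      rw [← hdrop, ih, map_zero]
  have hge : ∀ N, d ≤ N → component N F = 0 := fun N hN => by
    induction N, hN using Nat.le_induction with
    | base => exact h
    | succ k hk ih =>
      apply eq_zero_of_dropLast_eq_zero (hsym _) ((hd _).trans hk)
      rw [hdrop]
      exact ih
  apply Subtype.ext
  funext N
  rcases le_total N d with hN | hN
  · exact hle N hN
  · exact hge N hN

/-- Power sum monomials are homogeneous, so terms of weight above $d$ can be discarded. The weight
bound then controls the degree in every number of variables. -/
theorem exists_psumHom_eq {d : ℕ} {p : MvPolynomial (Fin d) ℂ} (hp : p.IsSymmetric)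
    (hd : p.totalDegree ≤ d) : ∃ P : MvPolynomial ℕ+ ℂ, (∀ m ∈ P.support, monomialWeight m ≤ d) ∧
      aeval (fun k : ℕ+ => psum (Fin d) ℂ k) P = p := by
  classical
  have hp' : p ∈ symmetricSubalgebra (Fin d) ℂ := hp
  rw [← range_psumHom] at hp'
  obtain ⟨Q, hQ⟩ := hp'
  have hQ : psumHom d Q = p := hQ
  rw [← aeval_psum_rename] at hQ
  set P := rename (finToPNat d) Q
  set T := aeval (R := ℂ) (fun k : ℕ+ => psum (Fin d) ℂ k) with hT
  refine ⟨∑ m ∈ P.support with monomialWeight m ≤ d, monomial m (P.coeff m), ?_, ?_⟩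
  · intro m hm
    obtain ⟨m', hm', hmm⟩ := mem_biUnion.1 (support_sum hm)
    have := support_monomial_subset hmm
    rw [mem_singleton] at this
    exact this ▸ (mem_filter.1 hm').2
  · rw [map_sum]
    have hcomp : ∀ j, homogeneousComponent j p =
        ∑ m ∈ P.support with monomialWeight m = j, T (monomial m (P.coeff m)) := by
      intro j
      rw [← hQ, P.as_sum, map_sum, map_sum, sum_filter, ← P.as_sum]
      refine sum_congr rfl fun m _ => ?_
      rw [homogeneousComponent_of_mem (aeval_psum_monomial_isHomogeneous d m _)]
      exact if_congr eq_comm rfl rfl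
    have hsum : p = ∑ j ∈ range (d + 1), homogeneousComponent j p := by
      rw [← sum_subset (range_mono (Nat.succ_le_succ hd)), sum_homogeneousComponent]
      intro j _ hj
      apply homogeneousComponent_eq_zero
      rw [mem_range] at hj
      omega
    rw [hsum, sum_congr rfl fun j _ => hcomp j]
    rw [← sum_fiberwise_of_maps_to (t := range (d + 1)) (g := monomialWeight)]
    · refine sum_congr rfl fun j hj => ?_
      rw [filter_filter]
      refine sum_congr ?_ fun _ _ => rfl
      ext m
      rw [mem_filter, mem_filter]
      rw [mem_range] at hj
      constructor
      · rintro ⟨h1, h2, h3⟩; exact ⟨h1, h3⟩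
      · rintro ⟨h1, h2⟩; exact ⟨h1, by omega, h2⟩
    · intro m hm
      rw [mem_range]
      exact Nat.lt_succ_of_le (mem_filter.1 hm).2

theorem powerSumHom_surjective : Function.Surjective powerSumHom := by
  intro F
  obtain ⟨hsym, hdrop, d, hd⟩ := F.2
  obtain ⟨P, hP, hPF⟩ := exists_psumHom_eq (hsym d) (hd d)
  refine ⟨P, ?_⟩
  rw [← sub_eq_zero]
  apply eq_zero_of_component_eq_zero (d := d)
  · intro N
    rw [map_sub, component_powerSumHom]
    refine (totalDegree_sub _ _).trans (max_le ?_ (hd N))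
    rw [P.as_sum, map_sum]
    exact totalDegree_finsetSum_le fun m hm =>
      (aeval_psum_monomial_isHomogeneous N m _).totalDegree_le.trans (hP m hm)
  · rw [map_sub, component_powerSumHom, hPF, component_apply, sub_self]

/-! ### Polynomial functions on Young diagrams -/

/-- The homomorphism taking the variables to the supersymmetric power sums. -/
def powerFunHom : MvPolynomial ℕ+ ℂ →ₐ[ℂ] (YoungDiagram → ℂ) := aeval powerFun

theorem range_powerFunHom : powerFunHom.range = PolyFun :=
  (Algebra.adjoin_range_eq_range_aeval ℂ powerFun).symm

/-- The modified coordinates of a diagram with at most `n` rows. -/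
def modCoords (n : ℕ) (la : YoungDiagram) (i : Fin n) : ℂ := (la.rowLen i : ℂ) - (i : ℕ) - 1 / 2

/-- The translation of the variables by constants. -/
def shiftHom (n : ℕ) (t : Fin n → ℂ) : MvPolynomial (Fin n) ℂ →ₐ[ℂ] MvPolynomial (Fin n) ℂ :=
  aeval fun i => X i - C (t i)

theorem shiftHom_injective (n : ℕ) (t : Fin n → ℂ) : Function.Injective (shiftHom n t) := by
  have h : (shiftHom n fun i => -t i).comp (shiftHom n t) = AlgHom.id ℂ _ := by
    apply algHom_ext
    intro i
    rw [AlgHom.comp_apply, shiftHom, shiftHom, aeval_X, map_sub, aeval_X, ← algebraMap_eq,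
      AlgHom.commutes, AlgHom.id_apply, map_neg, sub_neg_eq_add, add_sub_cancel_right]
  exact Function.LeftInverse.injective (g := shiftHom n fun i => -t i) fun p =>
    DFunLike.congr_fun h p

/-- On diagrams with at most $n$ rows, $p_k(\lambda)$ is an ordinary power sum in the modified
coordinates minus a constant, which `shiftHom` absorbs. -/
theorem powerFunHom_rename (n : ℕ) {la : YoungDiagram} (hl : la.colLen 0 ≤ n)
    (Q : MvPolynomial (Fin n) ℂ) :
    powerFunHom (rename (finToPNat n) Q) la = eval (modCoords n la)
      (psumHom n (shiftHom n (fun i => ∑ j ∈ range n, (-(j : ℂ) - 1 / 2) ^ ((i : ℕ) + 1)) Q)) := by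
  let t : Fin n → ℂ := fun i => ∑ j ∈ range n, (-(j : ℂ) - 1 / 2) ^ ((i : ℕ) + 1)
  have h : ((Pi.evalAlgHom ℂ (fun _ : YoungDiagram => ℂ) la).comp powerFunHom).comp
      (rename (finToPNat n)) =
      ((aeval (modCoords n la)).comp (psumHom n)).comp (shiftHom n t) := by
    apply algHom_ext
    intro i
    simp only [AlgHom.comp_apply, rename_X, powerFunHom, shiftHom, aeval_X, psumHom, map_sub,
      ← algebraMap_eq, AlgHom.commutes, Pi.evalAlgHom_apply]
    rw [powerFun_eq_sum_rows _ hl, sum_sub_distrib]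
    congr 1
    rw [psum, map_sum, ← Fin.sum_univ_eq_sum_range
      (fun j => ((la.rowLen j : ℂ) - j - 1 / 2) ^ (finToPNat n i : ℕ))]
    refine sum_congr rfl fun j _ => ?_
    rw [map_pow, aeval_X]
    rfl
  exact DFunLike.congr_fun h Q

/-- A polynomial vanishing at the modified coordinates of all diagrams is zero. -/
theorem eq_zero_of_eval_modCoords {n : ℕ} {p : MvPolynomial (Fin n) ℂ}
    (h : ∀ la : YoungDiagram, la.colLen 0 ≤ n → eval (modCoords n la) p = 0) : p = 0 := by
  classical
  set D := p.totalDegree + 1 with hD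
  -- Row $i$ takes its lengths from its own block of $D$ consecutive integers, with the blocks
  -- descending in $i$. Every point of the grid is therefore realized by a diagram, and $D$ exceeds
  -- the degree in each variable.
  let S : Fin n → Finset ℂ := fun i =>
    (range D).image fun r => (((n - 1 - i) * D + r : ℕ) : ℂ) - (i : ℕ) - 1 / 2
  apply eq_zero_of_eval_zero_at_prod_finset p S
  · intro i
    have hcard : (S i).card = D := by
      rw [card_image_of_injective, card_range]
      intro r s hrs
      simpa using hrs
    rw [hcard]
    exact Nat.lt_succ_of_le (degreeOf_le_totalDegree p i)
  · intro x hx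
    choose r hr hrx using fun i => mem_image.1 (hx i)
    let a : ℕ → ℕ := fun i => if h : i < n then (n - 1 - i) * D + r ⟨i, h⟩ else 0
    have ha : Antitone a := by
      apply antitone_nat_of_succ_le
      intro i
      by_cases hi : i + 1 < n
      · simp only [a]
        rw [dif_pos hi, dif_pos (by omega)]
        have h1 := mem_range.1 (hr ⟨i + 1, hi⟩)
        obtain ⟨b, hb⟩ : ∃ b, n - 1 - i = b + 1 := ⟨n - 1 - i - 1, by omega⟩
        rw [hb, show n - 1 - (i + 1) = b by omega, add_mul]
        omega
      · simp only [a]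
        rw [dif_neg hi]
        exact Nat.zero_le _
    have hr' := rowLen_diagramOfRows ha (M := n) fun i hi => dif_neg (not_lt.2 hi)
    have hx : x = modCoords n (diagramOfRows a n ha) := by
      funext i
      rw [modCoords, hr', ← hrx]
      simp only [a]
      rw [dif_pos i.2]
    rw [hx]
    apply h
    rw [← rowLen_eq_zero_iff, hr']
    exact dif_neg (lt_irrefl n)

theorem powerFunHom_injective : Function.Injective powerFunHom := by
  rw [injective_iff_map_eq_zero]
  intro P hP
  obtain ⟨n, Q, rfl⟩ := exists_rename_finToPNat P
  have h : Q = 0 := by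
    apply (injective_iff_map_eq_zero _).1 (shiftHom_injective n
      fun i => ∑ j ∈ range n, (-(j : ℂ) - 1 / 2) ^ ((i : ℕ) + 1))
    apply (injective_iff_map_eq_zero _).1 (psumHom_injective n)
    apply eq_zero_of_eval_modCoords
    intro la hl
    rw [← powerFunHom_rename n hl, hP, Pi.zero_apply]
  rw [h, map_zero]

/-- The identification of symmetric functions with polynomial functions on Young diagrams. -/
def identification : SymFun ≃ₐ[ℂ] PolyFun :=
  (AlgEquiv.ofBijective powerSumHom ⟨powerSumHom_injective, powerSumHom_surjective⟩).symm.trans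
    ((AlgEquiv.ofInjective powerFunHom powerFunHom_injective).trans
      (Subalgebra.equivOfEq _ _ range_powerFunHom))

theorem identification_powerSumHom (P : MvPolynomial ℕ+ ℂ) :
    (identification (powerSumHom P) : YoungDiagram → ℂ) = powerFunHom P := by
  have : (AlgEquiv.ofBijective powerSumHom
      ⟨powerSumHom_injective, powerSumHom_surjective⟩).symm (powerSumHom P) = P :=
    AlgEquiv.symm_apply_apply
      (AlgEquiv.ofBijective powerSumHom ⟨powerSumHom_injective, powerSumHom_surjective⟩) P
  rw [identification, AlgEquiv.trans_apply, this]
  rfl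

theorem isIdentification_identification : IsIdentification identification := fun k => by
  have := identification_powerSumHom (X k)
  rwa [powerSumHom, powerFunHom, aeval_X, aeval_X] at this

theorem IsIdentification.unique {Φ Ψ : SymFun ≃ₐ[ℂ] PolyFun} (hΦ : IsIdentification Φ)
    (hΨ : IsIdentification Ψ) : Φ = Ψ := by
  have h : (Φ : SymFun →ₐ[ℂ] PolyFun).comp powerSumHom =
      (Ψ : SymFun →ₐ[ℂ] PolyFun).comp powerSumHom := by
    apply algHom_ext
    intro k
    apply Subtype.ext
    simp only [AlgHom.comp_apply, powerSumHom, aeval_X]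
    exact (hΦ k).trans (hΨ k).symm
  ext1 F
  obtain ⟨P, rfl⟩ := powerSumHom_surjective F
  exact DFunLike.congr_fun h P

/-! ### The shifted Schur functions form a basis of the polynomial functions -/

/-- The multiset of the row lengths. -/
def parts (nu : YoungDiagram) : Multiset ℕ+ :=
  ((nu.rowLens.pmap (fun x hx => x.toPNat hx) nu.pos_of_mem_rowLens : List ℕ+) : Multiset ℕ+)

theorem map_coe_parts (nu : YoungDiagram) :
    (parts nu).map PNat.val = (nu.rowLens : Multiset ℕ) := by
  rw [parts, Multiset.map_coe, List.map_pmap]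
  congr 1
  exact List.pmap_eq_self.2 fun _ _ => rfl

theorem parts_injective : Function.Injective parts := by
  intro nu mu h
  have h1 := congrArg (Multiset.map PNat.val) h
  rw [map_coe_parts, map_coe_parts, Multiset.coe_eq_coe] at h1
  have h2 := h1.eq_of_sortedGE nu.rowLens_sorted mu.rowLens_sorted
  apply YoungDiagram.equivListRowLens.injective
  exact Subtype.ext h2

theorem sum_parts (nu : YoungDiagram) : ((parts nu).map PNat.val).sum = nu.card := by
  rw [map_coe_parts, Multiset.sum_coe, YoungDiagram.rowLens, card_eq_sum_rowLen le_rfl]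
  rfl

/-- The product of the functions `powerFun k` over a multiset of indices. -/
def powerFunProd (s : Multiset ℕ+) : YoungDiagram → ℂ := (s.map powerFun).prod

theorem powerFunProd_eq (s : Multiset ℕ+) :
    powerFunProd s = powerFunHom (monomial (Multiset.toFinsupp s) 1) := by
  induction s using Multiset.induction_on with
  | empty => simp [powerFunProd]
  | cons k s ih =>
    rw [powerFunProd, Multiset.map_cons, Multiset.prod_cons, ← powerFunProd, ih,
      ← Multiset.singleton_add, map_add, Multiset.toFinsupp_singleton,
      show ∀ a b : ℕ+ →₀ ℕ, monomial (a + b) (1 : ℂ) = monomial a 1 * monomial b 1 from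
        fun a b => by rw [monomial_mul, one_mul], map_mul]
    congr 1
    change powerFun k = powerFunHom (X k)
    rw [powerFunHom, aeval_X]

theorem linearIndependent_powerFunProd : LinearIndependent ℂ powerFunProd := by
  have h1 : LinearIndependent ℂ fun s : Multiset ℕ+ =>
      (monomial (Multiset.toFinsupp s) 1 : MvPolynomial ℕ+ ℂ) := by
    have := (basisMonomials ℕ+ ℂ).linearIndependent.comp _ Multiset.toFinsupp.injective
    simpa [Function.comp_def] using this
  have h2 := h1.map' powerFunHom.toLinearMap
    (LinearMap.ker_eq_bot.2 powerFunHom_injective)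
  have h3 : powerFunProd = powerFunHom.toLinearMap ∘ fun s : Multiset ℕ+ =>
      (monomial (Multiset.toFinsupp s) 1 : MvPolynomial ℕ+ ℂ) := funext powerFunProd_eq
  rwa [h3]

theorem powerFunProd_mem_schurSpan (s : Multiset ℕ+) :
    powerFunProd s ∈ schurSpan (s.map PNat.val).sum := by
  induction s using Multiset.induction_on with
  | empty => simpa [powerFunProd] using one_mem_schurSpan
  | cons k s ih =>
    simp only [powerFunProd, Multiset.map_cons, Multiset.prod_cons, Multiset.sum_cons]
    rw [add_comm]
    exact powerFun_mul_mem_schurSpan k ih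

theorem powerFunProd_mem_polyFun (s : Multiset ℕ+) : powerFunProd s ∈ PolyFun := by
  rw [powerFunProd]
  refine multiset_prod_mem _ fun f hf => ?_
  obtain ⟨k, -, rfl⟩ := Multiset.mem_map.1 hf
  exact Algebra.subset_adjoin ⟨k, rfl⟩

theorem finite_card_le (d : ℕ) : {nu : YoungDiagram | nu.card ≤ d}.Finite := by
  refine Set.Finite.of_finite_image (f := YoungDiagram.cells)
    ((range d ×ˢ range d).powerset.finite_toSet.subset ?_)
    (fun nu _ mu _ h => YoungDiagram.ext h)
  rintro _ ⟨nu, hnu, rfl⟩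
  rw [mem_coe, mem_powerset]
  rintro ⟨i, j⟩ h
  have hnu : nu.card ≤ d := hnu
  have h0 : (0, 0) ∈ nu := nu.up_left_mem (Nat.zero_le _) (Nat.zero_le _) h
  have h1 : nu.colLen j ≤ nu.card := by
    rw [YoungDiagram.colLen_eq_card]
    exact card_le_card (filter_subset _ _)
  have h2 : nu.rowLen i ≤ nu.card := by
    rw [YoungDiagram.rowLen_eq_card]
    exact card_le_card (filter_subset _ _)
  have h3 := YoungDiagram.mem_iff_lt_colLen.1 h
  have h4 := YoungDiagram.mem_iff_lt_rowLen.1 h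
  rw [mem_product, mem_range, mem_range]
  exact ⟨by dsimp only; omega, by dsimp only; omega⟩

/-- Comparison of dimensions in bounded degree. -/
theorem linearIndepOn_shiftedSchurFun_and_schurSpan_le (d : ℕ) :
    LinearIndepOn ℂ shiftedSchurFun {nu | nu.card ≤ d} ∧
      schurSpan d ≤ Subalgebra.toSubmodule PolyFun := by
  have : Fintype {nu : YoungDiagram | nu.card ≤ d} := (finite_card_le d).fintype
  let v : {nu : YoungDiagram | nu.card ≤ d} → YoungDiagram → ℂ := fun nu => powerFunProd (parts nu)
  let b : {nu : YoungDiagram | nu.card ≤ d} → YoungDiagram → ℂ := fun nu => shiftedSchurFun nu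
  have hv : LinearIndependent ℂ v :=
    linearIndependent_powerFunProd.comp _ (parts_injective.comp Subtype.val_injective)
  have hb : Submodule.span ℂ (Set.range b) = schurSpan d := by
    rw [schurSpan, Set.image_eq_range]
  have hfin : Module.Finite ℂ (schurSpan d) := by
    rw [← hb]
    exact Module.Finite.span_of_finite ℂ (Set.finite_range b)
  have hle : Submodule.span ℂ (Set.range v) ≤ schurSpan d := by
    rw [Submodule.span_le]
    rintro _ ⟨nu, rfl⟩
    refine schurSpan_mono ?_ (powerFunProd_mem_schurSpan (parts nu))
    rw [sum_parts]
    exact nu.2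
  -- The number of diagrams with at most $d$ boxes is the rank of the span of the products, hence at
  -- most the dimension of `schurSpan d`; that dimension is at most the same number, its generators
  -- being indexed by these diagrams. So equality holds throughout.
  have h1 := finrank_span_eq_card hv
  have h2 := Submodule.finrank_mono hle
  have h3 : Module.finrank ℂ (Submodule.span ℂ (Set.range b)) ≤ _ := finrank_range_le_card b
  rw [hb] at h3
  refine ⟨?_, ?_⟩
  · have : LinearIndependent ℂ b := by
      rw [linearIndependent_iff_card_eq_finrank_span, Set.finrank, hb]
      omega
    exact this
  · rw [← Submodule.eq_of_le_of_finrank_eq hle (by omega), Submodule.span_le]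
    rintro _ ⟨nu, rfl⟩
    exact powerFunProd_mem_polyFun _

theorem linearIndependent_shiftedSchurFun : LinearIndependent ℂ shiftedSchurFun := by
  rw [linearIndependent_iff_finset_linearIndependent]
  intro s
  have h := (linearIndepOn_shiftedSchurFun_and_schurSpan_le (s.sup YoungDiagram.card)).1
  exact h.mono fun nu hnu => le_sup (f := YoungDiagram.card) hnu

theorem span_shiftedSchurFun :
    Submodule.span ℂ (Set.range shiftedSchurFun) = Subalgebra.toSubmodule PolyFun := by
  apply le_antisymm
  · rw [Submodule.span_le]
    rintro _ ⟨nu, rfl⟩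
    exact (linearIndepOn_shiftedSchurFun_and_schurSpan_le nu.card).2
      (shiftedSchurFun_mem_schurSpan le_rfl)
  · have hle : ∀ d, schurSpan d ≤ Submodule.span ℂ (Set.range shiftedSchurFun) := fun d =>
      Submodule.span_mono (Set.image_subset_range _ _)
    intro f hf
    rw [Subalgebra.mem_toSubmodule, ← range_powerFunHom] at hf
    obtain ⟨P, rfl⟩ := hf
    change powerFunHom P ∈ _
    rw [P.as_sum, map_sum]
    refine Submodule.sum_mem _ fun m _ => ?_
    have h : powerFunHom (monomial m (P.coeff m)) =
        P.coeff m • powerFunProd (Finsupp.toMultiset m) := by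
      rw [powerFunProd_eq, Finsupp.toMultiset_toFinsupp, ← map_smul, smul_monomial, smul_eq_mul,
        mul_one]
    rw [h]
    exact Submodule.smul_mem _ _ (hle _ (powerFunProd_mem_schurSpan _))

/-- The basis of the shifted Schur functions. -/
def shiftedSchurBasis : Module.Basis YoungDiagram ℂ PolyFun :=
  (Module.Basis.span linearIndependent_shiftedSchurFun).map
    (LinearEquiv.ofEq _ _ span_shiftedSchurFun)

theorem shiftedSchurBasis_apply (nu : YoungDiagram) :
    (shiftedSchurBasis nu : YoungDiagram → ℂ) = shiftedSchurFun nu := by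
  rw [shiftedSchurBasis, Module.Basis.map_apply]
  exact congrArg Subtype.val (Module.Basis.span_apply linearIndependent_shiftedSchurFun nu)

/-- By stability, the condition for all $N$ reduces to one admissible $N$ for each pair of diagrams.
-/
theorem isFrobeniusSchur_iff {Φ : SymFun ≃ₐ[ℂ] PolyFun} {FS : YoungDiagram → SymFun} :
    IsFrobeniusSchur Φ FS ↔ ∀ nu, (Φ (FS nu) : YoungDiagram → ℂ) = shiftedSchurFun nu := by
  constructor
  · intro h nu
    funext la
    exact h nu la _ (le_max_left _ _) (le_max_right _ _)
  · intro h nu la N hn hl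
    rw [h, shiftedSchur_eq_fun hn hl]

/-! ### The Meixner difference operator -/

theorem sum_coeffA (z z' ξ : ℂ) (nu la : YoungDiagram) :
    ∑ c ∈ addable la, coeffA z z' ξ la c * shiftedSchurFun nu (addBox la c) =
      ξ / (1 - ξ) * (((la.card : ℂ) + nu.card + z * z') * shiftedSchurFun nu la +
        ∑ c ∈ removable nu, (z + content c) * (z' + content c) *
          shiftedSchurFun (removeBox nu c) la) := by
  rw [← sum_addable_shiftedSchurFun, mul_sum]
  refine sum_congr rfl fun c _ => ?_
  rw [coeffA]
  ring

theorem sum_coeffB (ξ : ℂ) (nu la : YoungDiagram) :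
    ∑ c ∈ removable la, coeffB ξ la c * shiftedSchurFun nu (removeBox la c) =
      1 / (1 - ξ) * (((la.card : ℂ) - nu.card) * shiftedSchurFun nu la) := by
  rw [← sum_removable_shiftedSchurFun, mul_sum]
  refine sum_congr rfl fun c _ => ?_
  rw [coeffB, mul_assoc]

/-- The case $\nu=\varnothing$ of both identities: the difference operator annihilates constants. -/
theorem sum_coeffA_add_sum_coeffB (z z' ξ : ℂ) (la : YoungDiagram) :
    ∑ c ∈ addable la, coeffA z z' ξ la c + ∑ c ∈ removable la, coeffB ξ la c =
      coeffC z z' ξ la := by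
  have hA := sum_coeffA z z' ξ ⊥ la
  have hB := sum_coeffB ξ ⊥ la
  have hr : removable ⊥ = ∅ := by
    ext c
    simp [mem_removable]
  simp only [shiftedSchurFun_bot, mul_one, hr, sum_empty, add_zero, YoungDiagram.card,
    YoungDiagram.cells_bot, card_empty, Nat.cast_zero, sub_zero] at hA hB
  rw [hA, hB, coeffC]
  ring

theorem difference_shiftedSchurFun {ξ : ℂ} (hξ : ξ ≠ 1) (z z' : ℂ) (nu la : YoungDiagram) :
    ∑ c ∈ addable la, coeffA z z' ξ la c * shiftedSchurFun nu (addBox la c) +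
        ∑ c ∈ removable la, coeffB ξ la c * shiftedSchurFun nu (removeBox la c) -
        coeffC z z' ξ la * shiftedSchurFun nu la =
      -(nu.card : ℂ) * shiftedSchurFun nu la + ξ / (1 - ξ) *
        ∑ c ∈ removable nu, (z + content c) * (z' + content c) *
          shiftedSchurFun (removeBox nu c) la := by
  have h : 1 - ξ ≠ 0 := sub_ne_zero.2 hξ.symm
  rw [sum_coeffA, sum_coeffB, coeffC]
  field_simp
  ring

/-- The difference operator on the functions on Young diagrams, evaluated at a diagram. -/
def differenceAt (z z' ξ : ℂ) (la : YoungDiagram) : (YoungDiagram → ℂ) →ₗ[ℂ] ℂ :=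
  ∑ c ∈ addable la, coeffA z z' ξ la c • LinearMap.proj (addBox la c) +
    ∑ c ∈ removable la, coeffB ξ la c • LinearMap.proj (removeBox la c) -
    coeffC z z' ξ la • LinearMap.proj la

theorem differenceAt_apply (z z' ξ : ℂ) (la : YoungDiagram) (f : YoungDiagram → ℂ) :
    differenceAt z z' ξ la f = ∑ c ∈ addable la, coeffA z z' ξ la c * f (addBox la c) +
      ∑ c ∈ removable la, coeffB ξ la c * f (removeBox la c) - coeffC z z' ξ la * f la := by
  simp [differenceAt, LinearMap.sum_apply]

theorem meixner_eq_differenceAt {Φ : SymFun ≃ₐ[ℂ] PolyFun}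
    {FS : Module.Basis YoungDiagram ℂ SymFun} (hFS : IsFrobeniusSchur Φ FS) {ξ : ℂ} (hξ : ξ ≠ 1)
    (z z' : ℂ) (F : SymFun) (la : YoungDiagram) :
    (Φ (meixner FS z z' ξ F) : YoungDiagram → ℂ) la =
      differenceAt z z' ξ la (Φ F : YoungDiagram → ℂ) := by
  rw [isFrobeniusSchur_iff] at hFS
  let ι : SymFun →ₗ[ℂ] (YoungDiagram → ℂ) := PolyFun.val.toLinearMap ∘ₗ Φ.toLinearMap
  have hι : ∀ nu, ι (FS nu) = shiftedSchurFun nu := hFS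
  -- Both sides are linear in `F`, so agreement on the Frobenius–Schur basis is enough.
  have h : LinearMap.proj la ∘ₗ ι ∘ₗ meixner FS z z' ξ = differenceAt z z' ξ la ∘ₗ ι := by
    apply FS.ext
    intro nu
    change ι (meixner FS z z' ξ (FS nu)) la = differenceAt z z' ξ la (ι (FS nu))
    rw [hι, differenceAt_apply,
      difference_shiftedSchurFun hξ, meixner, Module.Basis.constr_basis, map_add, map_smul,
      map_smul, map_sum, hι, Pi.add_apply, Pi.smul_apply, Pi.smul_apply,
      Finset.sum_apply, smul_eq_mul, smul_eq_mul]
    congr 2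
    refine sum_congr rfl fun c _ => ?_
    rw [map_smul, hι, Pi.smul_apply, smul_eq_mul]
  exact DFunLike.congr_fun h F

end MeixnerSym

end

open MeixnerSym in
theorem proposition10 :
    -- the identification of symmetric functions with polynomial functions on Young diagrams
    (∃! Φ : SymFun ≃ₐ[ℂ] PolyFun, IsIdentification Φ) ∧
    ∀ Φ : SymFun ≃ₐ[ℂ] PolyFun, IsIdentification Φ →
      -- the Frobenius-Schur functions are well defined and form a basis
      (∃! FS : Module.Basis YoungDiagram ℂ SymFun, IsFrobeniusSchur Φ FS) ∧
      ∀ FS : Module.Basis YoungDiagram ℂ SymFun, IsFrobeniusSchur Φ FS →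
        ∀ z z' ξ : ℂ, ξ ≠ 1 →
          -- the Meixner operator is implemented by a difference operator on Young diagrams
          (∀ (F : SymFun) (la : YoungDiagram),
            (Φ (meixner FS z z' ξ F) : YoungDiagram → ℂ) la =
              ∑ c ∈ addable la, coeffA z z' ξ la c * (Φ F : YoungDiagram → ℂ) (addBox la c) +
              ∑ c ∈ removable la, coeffB ξ la c * (Φ F : YoungDiagram → ℂ) (removeBox la c) -
              coeffC z z' ξ la * (Φ F : YoungDiagram → ℂ) la) ∧
          -- which can be written in two equivalent forms
          (∀ (f : YoungDiagram → ℂ) (la : YoungDiagram),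
            ∑ c ∈ addable la, coeffA z z' ξ la c * f (addBox la c) +
              ∑ c ∈ removable la, coeffB ξ la c * f (removeBox la c) - coeffC z z' ξ la * f la =
            ∑ c ∈ addable la, coeffA z z' ξ la c * (f (addBox la c) - f la) +
              ∑ c ∈ removable la, coeffB ξ la c * (f (removeBox la c) - f la)) := by
  refine ⟨⟨identification, isIdentification_identification, fun Φ hΦ =>
    hΦ.unique isIdentification_identification⟩, fun Φ _ => ⟨?_, ?_⟩⟩
  · have hB : ∀ nu, Φ (shiftedSchurBasis.map Φ.symm.toLinearEquiv nu) = shiftedSchurBasis nu :=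
      fun nu => by
        rw [Module.Basis.map_apply]
        exact Φ.apply_symm_apply _
    refine ⟨shiftedSchurBasis.map Φ.symm.toLinearEquiv, ?_, fun FS hFS => ?_⟩
    · exact isFrobeniusSchur_iff.2 fun nu => by rw [hB, shiftedSchurBasis_apply]
    · apply Module.Basis.eq_of_apply_eq
      intro nu
      apply Φ.injective
      apply Subtype.ext
      rw [hB, isFrobeniusSchur_iff.1 hFS, shiftedSchurBasis_apply]
  · intro FS hFS z z' ξ hξ
    refine ⟨fun F la => ?_, fun f la => ?_⟩
    · rw [meixner_eq_differenceAt hFS hξ, differenceAt_apply]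
    · rw [← sum_coeffA_add_sum_coeffB, add_mul, Finset.sum_mul, Finset.sum_mul]
      simp only [mul_sub, Finset.sum_sub_distrib]
      ring
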